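/- The double pentagon is the translation surface obtained from a regular pentagon and its centrally symmetric copy by gluing parallel sides by translations; label the five pairs of parallel sides by $1,\dots,5$. Directions of straight lines (opposite directions being identified) form $\mathbb{RP}^1$, viewed as the circle at infinity of the hyperbolic plane. The five directions of the sides of the regular pentagon are the vertices of an ideal pentagon, the pentagon of generation $0$ (its vertices being joined in their cyclic order on $\mathbb{RP}^1$). The pentagons of generation $k+1$ are the images of those of generation $k$ under the reflections in their sides, other than the side shared with a pentagon of generation $k-1$. In a direction that is a vertex of one of these pentagons, all non-singular trajectories on the surface are closed and form two strips of parallel trajectories, a shorter one and a longer one (with respect to Euclidean length). The short and the long symbolic orbit of this direction are the cyclic words of the labels of the sides consecutively crossed, over one period, by a trajectory of the shorter and of the longer strip. Theorem. Let $p,q$ be two directions joined by a side of an ideal pentagon of generation $k\ge 0$, and let $v_1,v_2,v_3$ be the additional vertices, listed in the direction from $p$ to $q$, of the pentagon of generation $k+1$ adjacent to this side. Then there are linear words $a,A,b,B$ such that the (short, long) symbolic orbits are, after closing up the linear words to cyclic words, $$p:\ (a,\ A);\qquad v_1:\ (bA,\ BaA);\qquad v_2:\ (AB,\ bBaA);\qquad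 v_3:\ (aB,\ AbB);\qquad q:\ (b,\ B).$$ That is, the cyclic symbolic orbits of $p$ and $q$ can be cut into linear words whose concatenations, closed up to cyclic words, are the symbolic orbits of $v_1,v_2,v_3$. -/

import Mathlib

open scoped LinearAlgebra.Projectivization

/-! ## The double pentagon

The plane is `ℂ`. The surface is glued from the regular pentagon `P` inscribed in the unit circle
and its centrally symmetric copy `-P`. Sides of `P` and the parallel sides of `-P` carry the labels
`1, 2, 3, 4, 5`, regarded as the elements of `ZMod 5` (so that `0` stands for `5`). The labels are
chosen so that sides with consecutive labels have neighbouring directions (at angle `π / 5`). -/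

/-- The vertices of the regular pentagon `P`, in counterclockwise order. -/
noncomputable def corner (k : ZMod 5) : ℂ :=
  Complex.exp (2 * Real.pi * Complex.I * ((k.val : ℂ) / 5))

/-- The initial vertex of the side of `P` with label `j`. -/
noncomputable def sideStart (j : ZMod 5) : ℂ := corner (3 * j)

/-- The final vertex of the side of `P` with label `j`. -/
noncomputable def sideEnd (j : ZMod 5) : ℂ := corner (3 * j + 1)

theorem sideEnd_sub_sideStart_ne_zero (j : ZMod 5) : sideEnd j - sideStart j ≠ 0 := by
  have key : ∀ m n : ZMod 5, corner m = corner n → m = n := by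
    intro m n h
    unfold corner at h
    rw [Complex.exp_eq_exp_iff_exists_int] at h
    obtain ⟨t, ht⟩ := h
    have h2 : (2 * Real.pi * Complex.I : ℂ) ≠ 0 := Complex.two_pi_I_ne_zero
    have h3 : ((m.val : ℂ) / 5) = (n.val : ℂ) / 5 + t := by
      apply mul_left_cancel₀ h2
      rw [ht]; ring
    have h4 : (m.val : ℂ) = (n.val : ℂ) + 5 * t := by
      field_simp at h3
      linear_combination h3
    have h5 : (m.val : ℤ) = (n.val : ℤ) + 5 * t := by exact_mod_cast h4
    have hm := ZMod.val_lt m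
    have hn := ZMod.val_lt n
    apply ZMod.val_injective
    omega
  intro h
  have h1 : (1 : ZMod 5) = 0 := by simpa using key _ _ (sub_eq_zero.mp h)
  exact absurd h1 (by decide)

/-- Twice the midpoint of the side of `P` with label `j`; it is an outward normal of that side, and
the translation by `- ε • sideNormal j` takes the side `j` of the pentagon `ε • P` to the parallel
side of the other pentagon. -/
noncomputable def sideNormal (j : ZMod 5) : ℂ := sideStart j + sideEnd j

/-- A linear trajectory leaving one of the two pentagons: `sheet = ε` says that it is the pentagon
`ε • P` (`ε = 1` or `-1`), `side` is the label of the side through which it leaves, and `point` is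
the point of that side, in the coordinates of the pentagon `ε • P`. -/
structure Crossing where
  sheet : ℤˣ
  side : ZMod 5
  point : ℂ

/-- A trajectory with direction vector `u` leaves the pentagon transversally through an interior
point of the side. -/
def Crossing.IsExit (u : ℂ) (s : Crossing) : Prop :=
  s.point ∈ openSegment ℝ (s.sheet • sideStart s.side) (s.sheet • sideEnd s.side) ∧
    0 < inner ℝ (s.sheet • sideNormal s.side) u

/-- The same point in the coordinates of the other pentagon, which the trajectory enters. -/
noncomputable def Crossing.entry (s : Crossing) : ℂ := s.point - s.sheet • sideNormal s.side

/-- The trajectory with direction vector `u` that crosses `s` crosses `t` next. -/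
def Crossing.Step (u : ℂ) (s t : Crossing) : Prop :=
  s.IsExit u ∧ t.IsExit u ∧ t.sheet = -s.sheet ∧ ∃ τ : ℝ, 0 < τ ∧ t.point = s.entry + τ • u

/-- `γ` lists the consecutive crossings of a closed linear trajectory of direction `p` that closes
up for the first time after `n` crossings. Directions are points of the real projective line:
opposite directions are identified. -/
def IsClosedTrajectory (p : ℙ ℝ ℂ) (n : ℕ) (γ : ℕ → Crossing) : Prop :=
  0 < n ∧ Function.Periodic γ n ∧ (∀ i, 0 < i → i < n → γ i ≠ γ 0) ∧
    ∃ u : ℂ, u ≠ 0 ∧ u ∈ p.submodule ∧ ∀ i, (γ i).Step u (γ (i + 1))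

/-- The cyclic word of the labels of the sides that are consecutively crossed. -/
def symbolicWord (n : ℕ) (γ : ℕ → Crossing) : Cycle (ZMod 5) :=
  (((List.range n).map fun i => (γ i).side : List (ZMod 5)) : Cycle (ZMod 5))

/-- The Euclidean length of the trajectory over one period. -/
noncomputable def trajectoryLength (n : ℕ) (γ : ℕ → Crossing) : ℝ :=
  ∑ i ∈ Finset.range n, ‖(γ (i + 1)).point - (γ i).entry‖

/-- The symbolic orbits of the shorter strip of closed trajectories of direction `p`. -/
def shortOrbits (p : ℙ ℝ ℂ) : Set (Cycle (ZMod 5)) :=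
  {w | ∃ n γ, IsClosedTrajectory p n γ ∧ symbolicWord n γ = w ∧
    ∀ n' γ', IsClosedTrajectory p n' γ' → trajectoryLength n γ ≤ trajectoryLength n' γ'}

/-- The symbolic orbits of the longer strip of closed trajectories of direction `p`. -/
def longOrbits (p : ℙ ℝ ℂ) : Set (Cycle (ZMod 5)) :=
  {w | ∃ n γ, IsClosedTrajectory p n γ ∧ symbolicWord n γ = w ∧
    ∀ n' γ', IsClosedTrajectory p n' γ' → trajectoryLength n' γ' ≤ trajectoryLength n γ}

/-- The short and the long symbolic orbit of direction `p` exist, are unique, and are the linear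
words `s` and `l` closed up to cyclic words. -/
def HasSymbolicOrbits (p : ℙ ℝ ℂ) (s l : List (ZMod 5)) : Prop :=
  shortOrbits p = {(s : Cycle (ZMod 5))} ∧ longOrbits p = {(l : Cycle (ZMod 5))}

/-! ## The tiling by ideal pentagons

The projective line of directions is the circle at infinity of the hyperbolic plane. An ideal
pentagon is given by its vertices, indexed by `ZMod 5` in cyclic order; its side `i` is the geodesic
with the ends `P i` and `P (i + 1)`. -/

/-- The pentagon of generation `0`: its vertices are the directions of the sides of the regular
pentagon. -/
noncomputable def initialPentagon (j : ZMod 5) : ℙ ℝ ℂ :=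
  Projectivization.mk ℝ (sideEnd j - sideStart j) (sideEnd_sub_sideStart_ne_zero j)

/-- `Q` is the image of `P` under the hyperbolic reflection in the side `i` of `P` (with the
vertices labelled accordingly). On the circle at infinity, the reflection in the geodesic with the
ends `p`, `q` is induced by the linear map that is `1` on the line `p` and `-1` on the line `q`. -/
def IsReflectionInSide (i : ZMod 5) (P Q : ZMod 5 → ℙ ℝ ℂ) : Prop :=
  ∃ g : ℂ ≃ₗ[ℝ] ℂ, (∀ u ∈ (P i).submodule, g u = u) ∧ (∀ w ∈ (P (i + 1)).submodule, g w = -w) ∧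
    ∀ j, Q j = g • P j

/-- `IsPentagon k o P`: `P` is a pentagon of generation `k` of the tiling, and `o` is its side in
common with a pentagon of the previous generation (`none` for `k = 0`). A pentagon of generation
`k + 1` is obtained from one of generation `k` by reflection in any other side. -/
inductive IsPentagon : ℕ → Option (ZMod 5) → (ZMod 5 → ℙ ℝ ℂ) → Prop
  | initial : IsPentagon 0 none initialPentagon
  | next {k : ℕ} {o : Option (ZMod 5)} {P Q : ZMod 5 → ℙ ℝ ℂ} {i : ZMod 5} :
      IsPentagon k o P → o ≠ some i → IsReflectionInSide i P Q → IsPentagon (k + 1) (some i) Q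

/-- The directions `p`, `q` are joined by a side of a pentagon of generation `k`, and the pentagon
of generation `k + 1` adjacent to that side has the additional vertices `v₁`, `v₂`, `v₃`, listed in
the direction from `p` to `q`. -/
def NextVertices (k : ℕ) (p v₁ v₂ v₃ q : ℙ ℝ ℂ) : Prop :=
  ∃ (o : Option (ZMod 5)) (P Q : ZMod 5 → ℙ ℝ ℂ) (i : ZMod 5),
    IsPentagon k o P ∧ o ≠ some i ∧ IsReflectionInSide i P Q ∧
    ((p = P i ∧ v₁ = Q (i - 1) ∧ v₂ = Q (i - 2) ∧ v₃ = Q (i - 3) ∧ q = P (i + 1)) ∨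
      (q = P i ∧ v₃ = Q (i - 1) ∧ v₂ = Q (i - 2) ∧ v₁ = Q (i - 3) ∧ p = P (i + 1)))

/-! ## Cyclic substitutions -/

/-! Sector `m` consists of the directions between those of the sides `m` and `m + 1`. The hyperbolic
reflection in the side of the initial pentagon that joins these two directions is induced by the
linear map `reflect m`, which carries the directions outside sector `m` into it.

On closed trajectories this reflection acts by a substitution. In sector `0` a trajectory passes
only between neighbours on the path `0, 2, 3, 4, 1`. The height differences along a straight run of
this walk telescope, so the run moves the trajectory exactly as a single passage between its two
ends does in the reflected direction. Hence inserting the labels in between turns loops into loops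
(`IsLoop.substitute`), and every loop of the sector arises this way (`IsLoop.exists_substitute`).
Displacements are transported linearly, so the ratio `φ` between the long and the short loop, read
off in the direction of a side (`hasLoops_sideVec_zero`), persists (`HasLoops.reflect`).

A pentagon of generation `k` is the image of the initial one under a product of `k` maps `reflect m`
without two equal consecutive factors. The five directions of the theorem are therefore images of a
fan over one side of the initial pentagon, and their ten words come from ten explicit words by
iterated substitution (`Reached`).

It remains to see that the cutting survives. If `a`, `A`, `b`, `B` begin with the same letter, the
substitution respects concatenation and the cut persists (`IsCommon.substitute`). The initial words
have no such letter, and none exists while the reflections alternate between two sides with a common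
vertex: that vertex is fixed, and its two words stay disjoint. These chains have a closed form, and
leaving the chain produces a common letter (`IsAlternating.substitute`).

Finally, the closed trajectories of a direction are the primitive loops, and `1 < φ < 2` singles out
the short and the long one (`HasLoops.hasSymbolicOrbits`). -/

/-- The position of a label on the path `0, 2, 3, 4, 1`. -/
def walkPos (c : ZMod 5) : ℕ := (![0, 4, 1, 2, 3] : Fin 5 → ℕ) c

/-- The labels strictly between `c` and `d` on the path `0, 2, 3, 4, 1`. -/
def between₀ (c d : ZMod 5) : List (ZMod 5) :=
  if walkPos c ≤ walkPos d then
    (([0, 2, 3, 4, 1] : List (ZMod 5)).take (walkPos d)).drop (walkPos c + 1)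
  else ((([0, 2, 3, 4, 1] : List (ZMod 5)).take (walkPos c)).drop (walkPos d + 1)).reverse

/-- The labels strictly between `c` and `d` on the path `m, m + 2, m + 3, m + 4, m + 1`. -/
def between (m c d : ZMod 5) : List (ZMod 5) := (between₀ (c - m) (d - m)).map (· + m)

/-- The word `l`, followed by the letter `t`, with every transition replaced by the straight walk on
the path `m, m + 2, m + 3, m + 4, m + 1`; the final `t` is omitted. -/
def insertWalks (m : ZMod 5) : List (ZMod 5) → ZMod 5 → List (ZMod 5)
  | [], _ => []
  | c :: l, t => c :: (between m c (l.headD t) ++ insertWalks m l t)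

/-- The substitution on cyclic words induced by the reflection in the side `m`. -/
def substitute (m : ZMod 5) (l : List (ZMod 5)) : List (ZMod 5) := insertWalks m l (l.headD 0)

/-! ### Powers, rotations and concatenation under the substitution. -/

/-- The `n`-fold concatenation of `l`. -/
def wordPow (l : List (ZMod 5)) (n : ℕ) : List (ZMod 5) := (List.replicate n l).flatten

@[simp] theorem wordPow_zero (l : List (ZMod 5)) : wordPow l 0 = [] := rfl

theorem wordPow_succ (l : List (ZMod 5)) (n : ℕ) : wordPow l (n + 1) = l ++ wordPow l n := by
  simp [wordPow, List.replicate_succ]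

@[simp] theorem wordPow_one (l : List (ZMod 5)) : wordPow l 1 = l := by simp [wordPow]

theorem append_wordPow {w x y : List (ZMod 5)} (h : w ++ x = y ++ w) (n : ℕ) :
    w ++ wordPow x n = wordPow y n ++ w := by
  induction n with
  | zero => simp
  | succ n ih => rw [wordPow_succ, wordPow_succ, ← List.append_assoc, h, List.append_assoc, ih,
      List.append_assoc]

theorem wordPow_succ' (l : List (ZMod 5)) (n : ℕ) : wordPow l (n + 1) = wordPow l n ++ l := by
  rw [wordPow_succ, append_wordPow rfl]

theorem length_wordPow (l : List (ZMod 5)) (n : ℕ) : (wordPow l n).length = n * l.length := by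
  simp [wordPow]

theorem headD_append (l₁ l₂ : List (ZMod 5)) (t : ZMod 5) :
    (l₁ ++ l₂).headD t = l₁.headD (l₂.headD t) := by
  cases l₁ <;> rfl

/-- The walk inserted at the seam depends on `l₂` only through its first letter. This is why cuts at
a common first letter are harmless. -/
theorem insertWalks_append (m : ZMod 5) (l₁ l₂ : List (ZMod 5)) (t : ZMod 5) :
    insertWalks m (l₁ ++ l₂) t = insertWalks m l₁ (l₂.headD t) ++ insertWalks m l₂ t := by
  induction l₁ with
  | nil => rfl
  | cons c l ih => simp [insertWalks, ih]

theorem headD_insertWalks (m : ZMod 5) (l : List (ZMod 5)) (t : ZMod 5) :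
    (insertWalks m l t).headD t = l.headD t := by
  cases l <;> rfl

theorem substitute_eq (m : ZMod 5) (l : List (ZMod 5)) (t : ZMod 5) :
    substitute m l = insertWalks m l (l.headD t) := by
  cases l <;> rfl

theorem substitute_append (m : ZMod 5) (l₁ l₂ : List (ZMod 5)) (t : ZMod 5) :
    substitute m (l₁ ++ l₂) =
      insertWalks m l₁ (l₂.headD (l₁.headD t)) ++ insertWalks m l₂ (l₁.headD (l₂.headD t)) := by
  rw [substitute_eq m _ t, insertWalks_append, headD_append]
  rcases l₁ with _ | ⟨c, l₁⟩ <;> rcases l₂ with _ | ⟨d, l₂⟩ <;> rfl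

theorem substitute_isRotated (m : ZMod 5) {l l' : List (ZMod 5)} (h : l ~r l') :
    substitute m l ~r substitute m l' := by
  obtain ⟨n, hn, rfl⟩ := List.isRotated_iff_mod.mp h
  rw [List.rotate_eq_drop_append_take hn]
  conv_lhs => rw [← List.take_append_drop n l]
  rw [substitute_append m _ _ 0, substitute_append m _ _ 0]
  exact List.isRotated_append

theorem substitute_ne_nil (m : ZMod 5) {l : List (ZMod 5)} (h : l ≠ []) : substitute m l ≠ [] := by
  cases l <;> simp_all [substitute, insertWalks]

theorem headD_wordPow_append (l l' : List (ZMod 5)) (t : ZMod 5) (h : l'.headD t = l.headD t)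
    (n : ℕ) : (wordPow l n ++ l').headD t = l.headD t := by
  cases n with
  | zero => simpa using h
  | succ n => rw [wordPow_succ, List.append_assoc, headD_append]; cases l <;> simp_all [wordPow]

theorem insertWalks_wordPow_append (m : ZMod 5) (l l' : List (ZMod 5)) (t z : ZMod 5)
    (h : l'.headD t = z) (h' : l.headD t = z) (n : ℕ) :
    insertWalks m (wordPow l n ++ l') t = wordPow (insertWalks m l z) n ++ insertWalks m l' t := by
  induction n with
  | zero => simp
  | succ n ih =>
    rw [wordPow_succ, List.append_assoc, insertWalks_append, ih, wordPow_succ,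
      headD_wordPow_append l l' t (h.trans h'.symm), h', List.append_assoc]

theorem substitute_wordPow (m : ZMod 5) (l : List (ZMod 5)) (n : ℕ) :
    substitute m (wordPow l n) = wordPow (substitute m l) n := by
  rcases n with _ | n
  · rfl
  have h := insertWalks_wordPow_append m l [] (l.headD 0) (l.headD 0) rfl
    (by cases l <;> rfl) (n + 1)
  rw [List.append_nil] at h
  have h2 : (wordPow l (n + 1)).headD 0 = l.headD 0 := by
    rw [wordPow_succ, headD_append]
    cases l <;> simp [wordPow]
  rw [substitute, h2, h, insertWalks, List.append_nil, substitute]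

theorem wordPow_rotate (a : List (ZMod 5)) (n k : ℕ) :
    (wordPow a n).rotate k = wordPow (a.rotate k) n := by
  have one : ∀ a : List (ZMod 5), (wordPow a n).rotate 1 = wordPow (a.rotate 1) n := by
    intro a
    rcases a with _ | ⟨c, a⟩
    · simp [wordPow]
    rcases n with _ | n
    · rfl
    have key : [c] ++ wordPow (a ++ [c]) n = wordPow (c :: a) n ++ [c] :=
      append_wordPow (by simp) n
    have h : (c :: a).rotate 1 = a ++ [c] := by simp
    rw [h, wordPow_succ, wordPow_succ, List.append_assoc, key]
    simp
  induction k generalizing a with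
  | zero => simp
  | succ k ih => rw [Nat.add_comm, ← List.rotate_rotate, one, ih, List.rotate_rotate]

theorem wordPow_isRotated {l l' : List (ZMod 5)} (h : l ~r l') (n : ℕ) :
    wordPow l n ~r wordPow l' n := by
  obtain ⟨k, rfl⟩ := h
  exact ⟨k, wordPow_rotate l n k⟩

/-- A rotation of a power is the same power of a rotation. -/
theorem exists_eq_wordPow_of_isRotated {l a : List (ZMod 5)} {n : ℕ} (h : l ~r wordPow a n) :
    ∃ a', a' ~r a ∧ l = wordPow a' n := by
  obtain ⟨k, rfl⟩ := h.symm
  exact ⟨a.rotate k, List.IsRotated.symm ⟨k, rfl⟩, wordPow_rotate a n k⟩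

/-- Conjugacy in the free monoid: if `w` is at least as long as `X`, a copy of `X` is cancelled from
the front of `w` and the equation recurs with a shorter `w`; otherwise `w` is a prefix of `X`. -/
theorem isRotated_of_append_eq {w U X : List (ZMod 5)} (h : w ++ U = X ++ w) : U ~r X := by
  induction hn : w.length using Nat.strong_induction_on generalizing w with
  | _ n ih =>
    rcases List.append_eq_append_iff.mp h with ⟨d, h1, h2⟩ | ⟨d, h1, h2⟩
    · rw [h1, h2]; exact List.isRotated_append
    · rcases X with _ | ⟨c, X⟩
      · have : U = [] := by simpa using h
        rw [this]
      · refine ih d.length ?_ (w := d) ?_ rfl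
        · rw [← hn, h1]; simp
        · rw [← h2, ← h1]

/-! ### Symmetries of the substitution. -/

theorem between_add (m k c d : ZMod 5) :
    between (m + k) (c + k) (d + k) = (between m c d).map (· + k) := by
  simp [between, List.map_map, Function.comp_def, add_assoc]

theorem insertWalks_map_add (m k : ZMod 5) (l : List (ZMod 5)) (t : ZMod 5) :
    insertWalks (m + k) (l.map (· + k)) (t + k) = (insertWalks m l t).map (· + k) := by
  induction l with
  | nil => rfl
  | cons c l ih =>
    simp [insertWalks, between_add, ih]

theorem substitute_map_add (m k : ZMod 5) (l : List (ZMod 5)) :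
    substitute (m + k) (l.map (· + k)) = (substitute m l).map (· + k) := by
  rw [substitute_eq _ _ (0 + k), substitute, ← insertWalks_map_add]
  cases l <;> rfl

/-- The map `c ↦ 1 - c` exchanges the labels `0` and `1` and reverses the path `0, 2, 3, 4, 1`; it
takes the pair `m, m + 1` to the pair belonging to `-m`. -/
theorem between_one_sub : ∀ m c d : ZMod 5,
    between (-m) (1 - c) (1 - d) = (between m c d).map (1 - ·) := by
  decide

theorem insertWalks_map_one_sub (m : ZMod 5) (l : List (ZMod 5)) (t : ZMod 5) :
    insertWalks (-m) (l.map (1 - ·)) (1 - t) = (insertWalks m l t).map (1 - ·) := by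
  induction l with
  | nil => rfl
  | cons c l ih =>
    simp [insertWalks, between_one_sub, ih]

theorem substitute_map_one_sub (m : ZMod 5) (l : List (ZMod 5)) :
    substitute (-m) (l.map (1 - ·)) = (substitute m l).map (1 - ·) := by
  rw [substitute_eq _ _ (1 - 0), substitute, ← insertWalks_map_one_sub]
  cases l <;> rfl

/-! ## Cutting the words -/

/-- The short and long words in the directions `p`, `v₁`, `v₂`, `v₃`, `q` of the theorem. -/
def tenWords (a A b B : List (ZMod 5)) : Fin 10 → List (ZMod 5) :=
  ![a, A, b ++ A, B ++ a ++ A, A ++ B, b ++ B ++ a ++ A, a ++ B, A ++ b ++ B, b, B]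

/-- Conjugation by one fixed word `w` is compatible with concatenation, so recutting all words by
the same `w` preserves products. -/
theorem insertWalks_conj_append {m z : ZMod 5} {w x y x' y' : List (ZMod 5)}
    (hy : y.head? = some z)
    (h : w ++ insertWalks m x z = x' ++ w) (h' : w ++ insertWalks m y z = y' ++ w) :
    w ++ insertWalks m (x ++ y) z = (x' ++ y') ++ w := by
  have : y.headD z = z := by cases y <;> simp_all
  rw [insertWalks_append, this, ← List.append_assoc, h, List.append_assoc, h', List.append_assoc]

theorem substitute_isRotated_of_conj {m z : ZMod 5} {w x x' : List (ZMod 5)}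
    (hx : x.head? = some z) (h : w ++ insertWalks m x z = x' ++ w) : substitute m x ~r x' := by
  have : substitute m x = insertWalks m x z := by cases x <;> simp_all [substitute]
  rw [this]
  exact isRotated_of_append_eq h

/-- If `a`, `A`, `B` begin with the same letter, then the substituted words can be cut, provided
that the images of `a`, `A`, `B` and `A ++ b` can be conjugated simultaneously. -/
theorem substitute_tenWords {m z : ZMod 5} {w a A b B a' A' b' B' : List (ZMod 5)}
    (ha : a.head? = some z) (hA : A.head? = some z) (hB : B.head? = some z)
    (ra : w ++ insertWalks m a z = a' ++ w) (rA : w ++ insertWalks m A z = A' ++ w)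
    (rB : w ++ insertWalks m B z = B' ++ w)
    (rC : w ++ insertWalks m (A ++ b) z = (A' ++ b') ++ w) (rb : substitute m b ~r b')
    (i : Fin 10) :
    substitute m (tenWords a A b B i) ~r tenWords a' A' b' B' i := by
  have hh : ∀ {x : List (ZMod 5)} (y), x.head? = some z → (x ++ y).head? = some z := by
    intro x y hx; simp [hx]
  have hC := hh b hA
  fin_cases i
  · exact substitute_isRotated_of_conj ha ra
  · exact substitute_isRotated_of_conj hA rA
  -- The word `b` need not begin with `z`; it enters the composite words only through the product `A
  -- ++ b`, up to rotation.
  · exact (substitute_isRotated m List.isRotated_append).trans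
      ((substitute_isRotated_of_conj hC rC).trans List.isRotated_append)
  · exact substitute_isRotated_of_conj (hh _ (hh _ hB))
      (insertWalks_conj_append hA (insertWalks_conj_append ha rB ra) rA)
  · exact substitute_isRotated_of_conj (hh _ hA) (insertWalks_conj_append hB rA rB)
  · have h := substitute_isRotated_of_conj (x := B ++ a ++ (A ++ b)) (hh _ (hh _ hB))
      (insertWalks_conj_append hC (insertWalks_conj_append ha rB ra) rC)
    have e : ∀ a A b B : List (ZMod 5), b ++ B ++ a ++ A ~r B ++ a ++ (A ++ b) := by
      intro a A b B
      have := List.isRotated_append (l := b) (l' := B ++ a ++ A)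
      simpa using this
    exact (substitute_isRotated m (e a A b B)).trans (h.trans (e a' A' b' B').symm)
  · exact substitute_isRotated_of_conj (hh _ ha) (insertWalks_conj_append hB ra rB)
  · exact substitute_isRotated_of_conj (hh _ hC) (insertWalks_conj_append hB rC rB)
  · exact rb
  · exact substitute_isRotated_of_conj hB rB

/-! ### Chains of reflections in two sides with a common vertex. -/

/-- The words obtained by reflecting alternately in two sides with a common vertex. -/
def chainWords (p ta mid q tq b : List (ZMod 5)) (n : ℕ) : Fin 10 → List (ZMod 5) :=
  tenWords (wordPow p n ++ ta) (wordPow p n ++ (mid ++ (wordPow q n ++ tq))) b p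

def evenChain : ℕ → Fin 10 → List (ZMod 5) :=
  chainWords [3, 4] [3, 4, 1, 4] [3, 4, 3] [2, 0] [2, 0, 2] [0, 2]

def oddChain : ℕ → Fin 10 → List (ZMod 5) :=
  chainWords [4, 3] [4, 3, 1, 3] [4, 3, 4] [0, 2] [0, 2, 0] [2, 0]

theorem head?_wordPow_append {p l : List (ZMod 5)} {z : ZMod 5} (hp : p.head? = some z)
    (hl : l.head? = some z) (n : ℕ) : (wordPow p n ++ l).head? = some z := by
  cases n with
  | zero => simpa using hl
  | succ n => rw [wordPow_succ, List.append_assoc]; simp [hp]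

/-- The conjugator `w` passes through `p ^ n`, is absorbed into `mid'`, and reappears at the end as
the final part of the image of `tq`; the block `q ^ n` is substituted without conjugation. All
conditions on the pieces are independent of `n`, so they can be decided for concrete words. -/
theorem substitute_chainWords {m z z' : ZMod 5}
    {p ta mid q tq b w p' ra mid' q' y b' : List (ZMod 5)}
    (hp : p.head? = some z) (hta : ta.head? = some z) (hmid : mid.head? = some z)
    (hq : q.head? = some z') (htq : tq.head? = some z')
    (ep : w ++ insertWalks m p z = p' ++ w) (eta : w ++ insertWalks m ta z = ra ++ w)
    (emid : w ++ insertWalks m mid z' = mid') (eq : insertWalks m q z' = q')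
    (etq : insertWalks m tq z = y ++ w) (etqb : insertWalks m (tq ++ b) z = y ++ b' ++ w)
    (rb : substitute m b ~r b') (n : ℕ) (i : Fin 10) :
    substitute m (chainWords p ta mid q tq b n i) ~r
      tenWords (wordPow p' n ++ ra) (wordPow p' n ++ (mid' ++ (wordPow q' n ++ y))) b' p' i := by
  have hd : ∀ {l : List (ZMod 5)} {t : ZMod 5}, l.head? = some t → ∀ s, l.headD s = t := by
    intro l t h s; cases l <;> simp_all
  have hpn := append_wordPow ep n
  have main : ∀ r : List (ZMod 5), r.head? = some z' →
      w ++ insertWalks m (wordPow p n ++ (mid ++ (wordPow q n ++ r))) z =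
        wordPow p' n ++ (mid' ++ (wordPow q' n ++ insertWalks m r z)) := by
    intro r hr
    rw [insertWalks_wordPow_append m p _ z z (by rw [headD_append, hd hmid]) (hd hp _),
      ← List.append_assoc, hpn, insertWalks_append, hd (head?_wordPow_append hq hr n),
      insertWalks_wordPow_append m q r z z' (hd hr _) (hd hq _), eq, List.append_assoc,
      ← List.append_assoc w, emid]
  refine substitute_tenWords (w := w) (z := z) (head?_wordPow_append hp hta n)
    (head?_wordPow_append hp (by simp [hmid]) n) hp ?_ ?_ ep ?_ rb i
  · rw [insertWalks_wordPow_append m p ta z z (hd hta _) (hd hp _), ← List.append_assoc, hpn,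
      List.append_assoc, eta, List.append_assoc]
  · rw [main tq htq, etq]; simp
  · have := main (tq ++ b) (by simp [htq])
    simp only [List.append_assoc] at this ⊢
    rw [this, etqb]; simp

/-- All ten words are cut at the same letter. -/
def IsCommon (ws : Fin 10 → List (ZMod 5)) : Prop :=
  ∃ (z : ZMod 5) (a A b B : List (ZMod 5)), a.head? = some z ∧ A.head? = some z ∧
    b.head? = some z ∧ B.head? = some z ∧ ∀ i, ws i ~r tenWords a A b B i

theorem IsCommon.substitute {ws : Fin 10 → List (ZMod 5)} (h : IsCommon ws) (m : ZMod 5) :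
    IsCommon fun i => _root_.substitute m (ws i) := by
  obtain ⟨z, a, A, b, B, ha, hA, hb, hB, h⟩ := h
  have hh : ∀ {x : List (ZMod 5)}, x.head? = some z → (insertWalks m x z).head? = some z := by
    intro x hx; cases x <;> simp_all [insertWalks]
  have e : ∀ x : List (ZMod 5), [] ++ insertWalks m x z = insertWalks m x z ++ [] := by simp
  refine ⟨z, insertWalks m a z, insertWalks m A z, insertWalks m b z, insertWalks m B z,
    hh ha, hh hA, hh hb, hh hB, fun i => (substitute_isRotated m (h i)).trans ?_⟩
  exact substitute_tenWords ha hA hB (e a) (e A) (e B)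
    (insertWalks_conj_append hb (e A) (e b)) (substitute_isRotated_of_conj hb (e b)) i

/-- The new long word begins with `p'`, or with `w` when `n = 0`; hence `z''` has to be the first
letter of both, as well as of `ra` and `b'`. -/
theorem isCommon_substitute_chainWords {m z z' z'' : ZMod 5}
    {p ta mid q tq b w p' ra y b' : List (ZMod 5)} {ws : Fin 10 → List (ZMod 5)} {n : ℕ}
    (hws : ∀ i, ws i ~r chainWords p ta mid q tq b n i)
    (hp : p.head? = some z) (hta : ta.head? = some z) (hmid : mid.head? = some z)
    (hq : q.head? = some z') (htq : tq.head? = some z')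
    (ep : w ++ insertWalks m p z = p' ++ w) (eta : w ++ insertWalks m ta z = ra ++ w)
    (etq : insertWalks m tq z = y ++ w) (etqb : insertWalks m (tq ++ b) z = y ++ b' ++ w)
    (rb : substitute m b ~r b')
    (hw : w.head? = some z'') (hp' : p'.head? = some z'') (hra : ra.head? = some z'')
    (hb' : b'.head? = some z'') :
    IsCommon fun i => substitute m (ws i) :=
  ⟨z'', _, _, b', p', head?_wordPow_append hp' hra n,
    head?_wordPow_append hp' (by simp [hw]) n, hb', hp', fun i =>
      (substitute_isRotated m (hws i)).trans
        (substitute_chainWords hp hta hmid hq htq ep eta rfl rfl etq etqb rb n i)⟩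

/-- The words belong to a chain of reflections in the sides `0` and `1`; the last one was in the
side `m`. -/
def IsAlternating (m : ZMod 5) (ws : Fin 10 → List (ZMod 5)) : Prop :=
  ∃ n, (m = 0 ∧ ∀ i, ws i ~r evenChain n i) ∨ (m = 1 ∧ ∀ i, ws i ~r oddChain n i)

theorem substitute_one_evenChain (n : ℕ) (i : Fin 10) :
    substitute 1 (evenChain n i) ~r oddChain (n + 1) i := by
  have h := substitute_chainWords (m := 1) (z := 3) (z' := 2) (p := [3, 4]) (ta := [3, 4, 1, 4])
    (mid := [3, 4, 3]) (q := [2, 0]) (tq := [2, 0, 2]) (b := [0, 2]) (w := [4]) (p' := [4, 3])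
    (ra := [4, 3, 4, 3, 1, 3]) (y := [2, 0, 2, 0]) (b' := [2, 0]) rfl rfl rfl rfl rfl
    (by decide) (by decide) rfl rfl (by decide) (by decide) (by decide) n i
  change substitute _ (chainWords _ _ _ _ _ _ n i) ~r _
  convert h using 1
  refine congrFun (f := oddChain (n + 1)) ?_ i
  have e1 : [4] ++ insertWalks 1 [3, 4, 3] 2 = [4, 3, 4, 3, 4] ++ ([0] : List (ZMod 5)) := by decide
  have e2 : insertWalks 1 [2, 0] 2 = [2, 0] := by decide
  have e3 : ([0] : List (ZMod 5)) ++ wordPow [2, 0] n = wordPow [0, 2] n ++ [0] :=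
    append_wordPow (by simp) n
  -- The letter `0` slides through `(2 0) ^ n` and turns it into `(0 2) ^ n`. Together with the tail
  -- this gives `(0 2) ^ (n + 1)`, while the first `4 3` joins the leading power.
  have e4 : ([4, 3, 4, 3, 4] ++ [0]) ++ (wordPow ([2, 0] : List (ZMod 5)) n ++ [2, 0, 2, 0]) =
      [4, 3, 4, 3, 4] ++ (wordPow [0, 2] n ++ [0] ++ [2, 0, 2, 0]) := by
    rw [← e3]; simp
  rw [oddChain, chainWords, e1, e2, e4, wordPow_succ', wordPow_succ']
  simp

theorem substitute_zero_oddChain (n : ℕ) (i : Fin 10) :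
    substitute 0 (oddChain n i) ~r evenChain (n + 1) i := by
  have h := substitute_chainWords (m := 0) (z := 4) (z' := 0) (p := [4, 3]) (ta := [4, 3, 1, 3])
    (mid := [4, 3, 4]) (q := [0, 2]) (tq := [0, 2, 0]) (b := [2, 0]) (w := [3]) (p' := [3, 4])
    (ra := [3, 4, 3, 4, 1, 4]) (y := [0, 2, 0, 2]) (b' := [0, 2]) rfl rfl rfl rfl rfl
    (by decide) (by decide) rfl rfl (by decide) (by decide) (by decide) n i
  change substitute _ (chainWords _ _ _ _ _ _ n i) ~r _
  convert h using 1
  refine congrFun (f := evenChain (n + 1)) ?_ i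
  have e1 : [3] ++ insertWalks 0 [4, 3, 4] 0 = [3, 4, 3, 4, 3] ++ ([2] : List (ZMod 5)) := by decide
  have e2 : insertWalks 0 [0, 2] 0 = [0, 2] := by decide
  have e3 : ([2] : List (ZMod 5)) ++ wordPow [0, 2] n = wordPow [2, 0] n ++ [2] :=
    append_wordPow (by simp) n
  have e4 : ([3, 4, 3, 4, 3] ++ [2]) ++ (wordPow ([0, 2] : List (ZMod 5)) n ++ [0, 2, 0, 2]) =
      [3, 4, 3, 4, 3] ++ (wordPow [2, 0] n ++ [2] ++ [0, 2, 0, 2]) := by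
    rw [← e3]; simp
  rw [evenChain, chainWords, e1, e2, e4, wordPow_succ', wordPow_succ']
  simp

theorem IsAlternating.substitute {m m' : ZMod 5} {ws : Fin 10 → List (ZMod 5)}
    (h : IsAlternating m ws)
    (hm : m' ≠ m) :
    IsAlternating m' (fun i => _root_.substitute m' (ws i)) ∨
      IsCommon fun i => _root_.substitute m' (ws i) := by
  obtain ⟨n, ⟨rfl, h⟩ | ⟨rfl, h⟩⟩ := h
  · fin_cases m'
    · exact absurd rfl hm
    · exact .inl ⟨n + 1, .inr ⟨rfl, fun i =>
        (substitute_isRotated 1 (h i)).trans (substitute_one_evenChain n i)⟩⟩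
    -- Leaving the chain: `z''` is a letter occurring in the images of both `p` and `b`, and `w` is
    -- the suffix of the image of `p` that starts there. If that image is `s ++ w`, then `p' = w ++
    -- s`. The other exits follow the same recipe.
    · refine .inr (isCommon_substitute_chainWords (m := 2) (w := [4, 0, 1])
        (p' := [4, 0, 1, 3, 1, 0]) (ra := [4, 0, 1, 3, 1, 0, 4, 0, 1, 0])
        (y := [2, 4, 0, 4, 2]) (b' := [4, 0, 4, 2]) (z'' := 4) h rfl rfl rfl rfl rfl
        ?_ ?_ ?_ ?_ ?_ rfl rfl rfl rfl) <;> decide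
    · refine .inr (isCommon_substitute_chainWords (m := 3) (w := [2, 1, 0])
        (p' := [2, 1, 0, 3, 0, 1, 2, 4]) (ra := [2, 1, 0, 3, 0, 1, 2, 4, 2, 1, 2, 4])
        (y := [2, 1, 0, 1]) (b' := [2, 1, 0, 1]) (z'' := 2) h rfl rfl rfl rfl rfl
        ?_ ?_ ?_ ?_ ?_ rfl rfl rfl rfl) <;> decide
    · refine .inr (isCommon_substitute_chainWords (m := 4) (w := [2])
        (p' := [2, 3, 2, 1, 4, 1]) (ra := [2, 3, 2, 1, 4, 1, 4, 1])
        (y := [2, 3, 0, 3]) (b' := [2, 3, 0, 3]) (z'' := 2) h rfl rfl rfl rfl rfl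
        ?_ ?_ ?_ ?_ ?_ rfl rfl rfl rfl) <;> decide
  · fin_cases m'
    · exact .inl ⟨n + 1, .inl ⟨rfl, fun i =>
        (substitute_isRotated 0 (h i)).trans (substitute_zero_oddChain n i)⟩⟩
    · exact absurd rfl hm
    · refine .inr (isCommon_substitute_chainWords (m := 2) (w := [0])
        (p' := [0, 4, 0, 1, 3, 1]) (ra := [0, 4, 0, 1, 3, 1, 3, 1])
        (y := [0, 4, 2, 4]) (b' := [0, 4, 2, 4]) (z'' := 0) h rfl rfl rfl rfl rfl
        ?_ ?_ ?_ ?_ ?_ rfl rfl rfl rfl) <;> decide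
    · refine .inr (isCommon_substitute_chainWords (m := 3) (w := [0, 1, 2])
        (p' := [0, 1, 2, 4, 2, 1, 0, 3]) (ra := [0, 1, 2, 4, 2, 1, 0, 3, 0, 1, 0, 3])
        (y := [0, 1, 2, 1]) (b' := [0, 1, 2, 1]) (z'' := 0) h rfl rfl rfl rfl rfl
        ?_ ?_ ?_ ?_ ?_ rfl rfl rfl rfl) <;> decide
    · refine .inr (isCommon_substitute_chainWords (m := 4) (w := [3, 2, 1])
        (p' := [3, 2, 1, 4, 1, 2]) (ra := [3, 2, 1, 4, 1, 2, 3, 2, 1, 2])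
        (y := [0, 3, 2, 3, 0]) (b' := [3, 2, 3, 0]) (z'' := 3) h rfl rfl rfl rfl rfl
        ?_ ?_ ?_ ?_ ?_ rfl rfl rfl rfl) <;> decide

/-- The reflection of the labels that exchanges the two ends of the chain. -/
def mirror (ws : Fin 10 → List (ZMod 5)) (i : Fin 10) : List (ZMod 5) :=
  (ws (![8, 9, 6, 7, 4, 5, 2, 3, 0, 1] i)).map (1 - ·)

theorem mirror_mirror (ws : Fin 10 → List (ZMod 5)) : mirror (mirror ws) = ws := by
  funext i
  fin_cases i <;> simp [mirror]

theorem mirror_substitute (m : ZMod 5) (ws : Fin 10 → List (ZMod 5)) :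
    mirror (fun i => substitute m (ws i)) = fun i => substitute (-m) (mirror ws i) := by
  funext i
  exact (substitute_map_one_sub m _).symm

theorem mirror_isRotated {ws ws' : Fin 10 → List (ZMod 5)} (h : ∀ i, ws i ~r ws' i) (i : Fin 10) :
    mirror ws i ~r mirror ws' i :=
  (h _).map _

theorem mirror_tenWords (a A b B : List (ZMod 5)) (i : Fin 10) :
    mirror (tenWords a A b B) i ~r tenWords (b.map (1 - ·)) (B.map (1 - ·)) (a.map (1 - ·))
      (A.map (1 - ·)) i := by
  fin_cases i
  · rfl
  · rfl
  · change (a ++ B).map _ ~r _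
    rw [List.map_append]; rfl
  · change (A ++ b ++ B).map _ ~r _
    rw [List.map_append, List.map_append]; rfl
  · change (A ++ B).map _ ~r _
    rw [List.map_append]; exact List.isRotated_append
  · change (b ++ B ++ a ++ A).map _ ~r a.map _ ++ A.map _ ++ b.map _ ++ B.map _
    have := List.isRotated_append (l := b.map (1 - ·) ++ B.map (1 - ·))
      (l' := a.map (1 - ·) ++ A.map (1 - ·))
    simpa using this
  · change (b ++ A).map _ ~r _
    rw [List.map_append]; rfl
  · change (B ++ a ++ A).map _ ~r _
    rw [List.map_append, List.map_append]; rfl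
  · rfl
  · rfl

theorem IsCommon.mirror {ws : Fin 10 → List (ZMod 5)} (h : IsCommon ws) :
    IsCommon (mirror ws) := by
  obtain ⟨z, a, A, b, B, ha, hA, hb, hB, h⟩ := h
  have hh : ∀ {x : List (ZMod 5)}, x.head? = some z → (x.map (1 - ·)).head? = some (1 - z) := by
    intro x hx; cases x <;> simp_all
  exact ⟨1 - z, _, _, _, _, hh hb, hh hB, hh ha, hh hA, fun i =>
    (mirror_isRotated h i).trans (mirror_tenWords a A b B i)⟩

/-- The words in the initial directions. -/
def baseWords : Fin 10 → List (ZMod 5) := tenWords [1, 4] [3, 2] [0, 2] [3, 4]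

/-- The words obtained from the initial ones by reflections, the last one in the side `m`. -/
inductive Reached : ZMod 5 → (Fin 10 → List (ZMod 5)) → Prop
  | base : Reached 0 baseWords
  | step {m m' : ZMod 5} {ws : Fin 10 → List (ZMod 5)} : Reached m ws → m' ≠ m →
      Reached m' fun i => substitute m' (ws i)

/-- The vertex `q` lies on the sides `0` and `1`, the vertex `p` on the sides `0` and `4`.
Alternating reflections thus form a chain around `q` or its mirror image around `p`; every other
sequence has reached a common first letter. -/
theorem Reached.cases {m : ZMod 5} {ws : Fin 10 → List (ZMod 5)} (h : Reached m ws) :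
    (m = 0 ∧ ws = baseWords) ∨ IsAlternating m ws ∨
      IsAlternating (-m) (mirror ws) ∨ IsCommon ws := by
  induction h with
  | base => exact .inl ⟨rfl, rfl⟩
  | @step m m' ws _ hm ih =>
    rcases ih with ⟨rfl, rfl⟩ | h | h | h
    · fin_cases m'
      · exact absurd rfl hm
      · refine .inr (.inl ⟨0, .inr ⟨rfl, ?_⟩⟩)
        decide
      -- The side `2`, like the side `3` below, has no vertex in common with the side `0`, and a
      -- common letter appears at once.
      · refine .inr (.inr (.inr ⟨4, [4, 0, 1, 0], [4, 0, 1, 3, 1, 0, 4, 2], [4, 0, 4, 2],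
          [4, 0, 1, 3, 1, 0], rfl, rfl, rfl, rfl, ?_⟩))
        decide
      · refine .inr (.inr (.inr ⟨2, [2, 1, 2, 4], [2, 1, 0, 3, 0, 1], [2, 1, 0, 1],
          [2, 1, 0, 3, 0, 1, 2, 4], rfl, rfl, rfl, rfl, ?_⟩))
        decide
      · refine .inr (.inr (.inl ⟨0, .inr ⟨by decide, ?_⟩⟩))
        decide
    · rcases h.substitute hm with h | h
      · exact .inr (.inl h)
      · exact .inr (.inr (.inr h))
    · rcases h.substitute (neg_injective.ne hm) with h | h
      · rw [← mirror_substitute] at h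
        exact .inr (.inr (.inl h))
      · rw [← mirror_substitute] at h
        have := h.mirror
        rw [mirror_mirror] at this
        exact .inr (.inr (.inr this))
    · exact .inr (.inr (.inr (h.substitute m')))

/-- The cyclic words can be cut into linear words. -/
theorem Reached.exists_tenWords {m : ZMod 5} {ws : Fin 10 → List (ZMod 5)} (h : Reached m ws) :
    ∃ a A b B, ∀ i, ws i ~r tenWords a A b B i := by
  have key : ∀ {m ws}, IsAlternating m ws → ∃ a A b B, ∀ i, ws i ~r tenWords a A b B i := by
    rintro m ws ⟨n, ⟨-, h⟩ | ⟨-, h⟩⟩ <;> exact ⟨_, _, _, _, h⟩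
  rcases h.cases with ⟨rfl, rfl⟩ | h | h | ⟨-, a, A, b, B, -, -, -, -, h⟩
  · exact ⟨_, _, _, _, fun i => .refl _⟩
  · exact key h
  · obtain ⟨a, A, b, B, h⟩ := key h
    have h' := mirror_isRotated h
    rw [mirror_mirror] at h'
    exact ⟨_, _, _, _, fun i => (h' i).trans (mirror_tenWords a A b B i)⟩
  · exact ⟨a, A, b, B, h⟩

/-! ## The first return dynamics and its renormalization -/

/-- A step of a trajectory, in terms of the heights above the midpoints of the sides: `X c` is the
(signed) height of the side `c`, and `M c` the height of its midpoint, both doubled. -/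
def HeightStep (X M : ZMod 5 → ℝ) (s t : ZMod 5 × ℝ) : Prop :=
  (X s.1 < 0 ∧ 0 < X t.1 ∧ X s.1 < s.2 ∧ s.2 < -X s.1 ∧ -X t.1 < t.2 ∧ t.2 < X t.1 ∧
      t.2 = s.2 - (M t.1 - M s.1)) ∨
    (0 < X s.1 ∧ X t.1 < 0 ∧ -X s.1 < s.2 ∧ s.2 < X s.1 ∧ X t.1 < t.2 ∧ t.2 < -X t.1 ∧
      t.2 = s.2 + (M t.1 - M s.1))

/-- A path of steps from `s` to `t`, along which the labels in `l` are crossed (the label of `t` is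
omitted). -/
def IsPath (R : ZMod 5 × ℝ → ZMod 5 × ℝ → Prop) :
    ZMod 5 × ℝ → List (ZMod 5) → ZMod 5 × ℝ → Prop
  | s, [], t => s = t
  | s, c :: l, t => s.1 = c ∧ ∃ s', R s s' ∧ IsPath R s' l t

section IsPath

variable {R : ZMod 5 × ℝ → ZMod 5 × ℝ → Prop}

theorem IsPath.headD_eq {s t : ZMod 5 × ℝ} {l : List (ZMod 5)} (h : IsPath R s l t) :
    l.headD t.1 = s.1 := by
  cases l with
  | nil => rw [show s = t from h]; rfl
  | cons c l => exact h.1.symm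

theorem isPath_append {s t : ZMod 5 × ℝ} {l₁ l₂ : List (ZMod 5)} :
    IsPath R s (l₁ ++ l₂) t ↔ ∃ r, IsPath R s l₁ r ∧ IsPath R r l₂ t := by
  induction l₁ generalizing s with
  | nil => simp [IsPath]
  | cons c l ih =>
    simp only [List.cons_append, IsPath, ih]
    constructor
    · rintro ⟨h, s', h1, r, h2, h3⟩; exact ⟨r, ⟨h, s', h1, h2⟩, h3⟩
    · rintro ⟨r, ⟨h, s', h1, h2⟩, h3⟩; exact ⟨h, s', h1, r, h2, h3⟩

theorem IsPath.append {s r t : ZMod 5 × ℝ} {l₁ l₂ : List (ZMod 5)} (h₁ : IsPath R s l₁ r)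
    (h₂ : IsPath R r l₂ t) : IsPath R s (l₁ ++ l₂) t :=
  isPath_append.mpr ⟨r, h₁, h₂⟩

theorem IsPath.map {R' : ZMod 5 × ℝ → ZMod 5 × ℝ → Prop} {f : ZMod 5 → ZMod 5} {g : ℝ → ℝ}
    (hR : ∀ s t, R s t → R' (f s.1, g s.2) (f t.1, g t.2)) {s t : ZMod 5 × ℝ}
    {l : List (ZMod 5)} (h : IsPath R s l t) :
    IsPath R' (f s.1, g s.2) (l.map f) (f t.1, g t.2) := by
  induction l generalizing s with
  | nil => rw [show s = t from h]; rfl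
  | cons c l ih =>
    obtain ⟨h1, s', h2, h3⟩ := h
    exact ⟨by rw [h1], _, hR _ _ h2, ih h3⟩

/-- The labels of a closed path. -/
def IsLoop (R : ZMod 5 × ℝ → ZMod 5 × ℝ → Prop) (l : List (ZMod 5)) : Prop :=
  l ≠ [] ∧ ∃ s, IsPath R s l s

theorem IsLoop.isRotated {l l' : List (ZMod 5)} (h : IsLoop R l) (hl : l ~r l') : IsLoop R l' := by
  obtain ⟨n, hn, rfl⟩ := List.isRotated_iff_mod.mp hl
  rw [List.rotate_eq_drop_append_take hn]
  obtain ⟨hne, s, hs⟩ := h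
  rw [← List.take_append_drop n l] at hs
  obtain ⟨r, h1, h2⟩ := isPath_append.mp hs
  refine ⟨fun h => hne ?_, r, h2.append h1⟩
  have := congrArg List.length h
  have h3 := congrArg List.length (List.take_append_drop n l)
  simp only [List.length_append, List.length_nil] at this h3
  exact List.eq_nil_of_length_eq_zero (by omega)

theorem isPath_of_isChain {v : ZMod 5 → ℝ} {c d : ZMod 5} {l : List (ZMod 5)}
    (h : List.IsChain (fun a b => R (a, v a) (b, v b)) (c :: (l ++ [d]))) :
    IsPath R (c, v c) (c :: l) (d, v d) := by
  induction l generalizing c with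
  | nil => exact ⟨rfl, _, by simpa using h, rfl⟩
  | cons e l ih =>
    rw [List.cons_append, List.isChain_cons_cons] at h
    exact ⟨rfl, _, h.1, ih h.2⟩

end IsPath

/-! ### Explicit heights in terms of two coordinates of the direction. -/

/-- The heights of the sides, for the direction vector with coordinates `x`, `y`. -/
noncomputable def sideHeight (x y : ℝ) (c : ZMod 5) : ℝ :=
  (![-y, -x, Real.goldenRatio * x + y, -(Real.goldenRatio * (x + y)), x + Real.goldenRatio * y] :
    Fin 5 → ℝ) c

/-- The heights of the midpoints of the sides, for the direction vector with coordinates `x`, `y`,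
doubled and relative to the side `0`. -/
noncomputable def midHeight (x y : ℝ) (c : ZMod 5) : ℝ :=
  (![0, (2 * Real.goldenRatio + 1) * (x + y), Real.goldenRatio * x,
      Real.goldenRatio * x + (Real.goldenRatio + 1) * y,
      (2 * Real.goldenRatio + 1) * x + (Real.goldenRatio + 1) * y] : Fin 5 → ℝ) c

section values

variable (x y : ℝ)

theorem sideHeight_zero : sideHeight x y 0 = -y := rfl
theorem sideHeight_one : sideHeight x y 1 = -x := rfl
theorem sideHeight_two : sideHeight x y 2 = Real.goldenRatio * x + y := rfl
theorem sideHeight_three : sideHeight x y 3 = -(Real.goldenRatio * (x + y)) := rfl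
theorem sideHeight_four : sideHeight x y 4 = x + Real.goldenRatio * y := rfl
theorem midHeight_zero : midHeight x y 0 = 0 := rfl
theorem midHeight_one : midHeight x y 1 = (2 * Real.goldenRatio + 1) * (x + y) := rfl
theorem midHeight_two : midHeight x y 2 = Real.goldenRatio * x := rfl
theorem midHeight_three :
    midHeight x y 3 = Real.goldenRatio * x + (Real.goldenRatio + 1) * y := rfl
theorem midHeight_four :
    midHeight x y 4 = (2 * Real.goldenRatio + 1) * x + (Real.goldenRatio + 1) * y := rfl

end values


theorem label_cases (c : ZMod 5) : c = 0 ∨ c = 1 ∨ c = 2 ∨ c = 3 ∨ c = 4 := by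
  revert c; decide

theorem goldenRatio_bounds : 3 / 2 ≤ Real.goldenRatio ∧ Real.goldenRatio ≤ 2 := by
  constructor
  · nlinarith [Real.goldenRatio_sq, Real.one_lt_goldenRatio]
  · exact Real.goldenRatio_lt_two.le

theorem goldenRatio_mul_bounds {x : ℝ} (hx : 0 ≤ x) :
    3 / 2 * x ≤ Real.goldenRatio * x ∧ Real.goldenRatio * x ≤ 2 * x :=
  ⟨mul_le_mul_of_nonneg_right goldenRatio_bounds.1 hx,
    mul_le_mul_of_nonneg_right goldenRatio_bounds.2 hx⟩

/-! ### Straight walks as reflections of single steps. -/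

/-- In directions of the sector `0`, trajectories walk on the path `0, 2, 3, 4, 1`. -/
theorem HeightStep.walk {x y : ℝ} (hx : 0 ≤ x) (hy : 0 ≤ y) {s n : ZMod 5 × ℝ}
    (h : HeightStep (sideHeight x y) (midHeight x y) s n) :
    (walkPos n.1 = walkPos s.1 + 1 ∧ n.2 = s.2 + (midHeight (-x) y n.1 - midHeight (-x) y s.1)) ∨
      (walkPos n.1 + 1 = walkPos s.1 ∧
        n.2 = s.2 - (midHeight (-x) y n.1 - midHeight (-x) y s.1)) := by
  obtain ⟨hx1, hx2⟩ := goldenRatio_mul_bounds hx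
  obtain ⟨hy1, hy2⟩ := goldenRatio_mul_bounds hy
  obtain ⟨c, η⟩ := s
  obtain ⟨d, η'⟩ := n
  rcases h with ⟨h1, h2, h3, h4, h5, h6, h7⟩ | ⟨h1, h2, h3, h4, h5, h6, h7⟩ <;>
  simp only at h1 h2 h3 h4 h5 h6 h7 ⊢ <;>
  rcases label_cases c with rfl | rfl | rfl | rfl | rfl <;>
  simp only [sideHeight_zero, sideHeight_one, sideHeight_two, sideHeight_three,
    sideHeight_four] at h1 h3 h4 <;>
  first
  | (exfalso; linarith)
  | (rcases label_cases d with rfl | rfl | rfl | rfl | rfl <;>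
      simp only [sideHeight_zero, sideHeight_one, sideHeight_two, sideHeight_three,
    sideHeight_four, midHeight_zero, midHeight_one, midHeight_two, midHeight_three,
    midHeight_four] at h2 h5 h6 h7 <;>
      first
      | (exfalso; linarith)
      | (left; exact ⟨rfl, by
          simp only [midHeight_zero, midHeight_one, midHeight_two, midHeight_three,
            midHeight_four]
          linarith⟩)
      | (right; exact ⟨rfl, by
          simp only [midHeight_zero, midHeight_one, midHeight_two, midHeight_three,
            midHeight_four]
          linarith⟩))

/-- The unsigned heights of the sides, for a direction in the sector `0`. -/
noncomputable def sideLength (x y : ℝ) (c : ZMod 5) : ℝ :=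
  (![y, x, Real.goldenRatio * x + y, Real.goldenRatio * (x + y), x + Real.goldenRatio * y] :
    Fin 5 → ℝ) c

section values

variable (x y : ℝ)

theorem sideLength_zero : sideLength x y 0 = y := rfl
theorem sideLength_one : sideLength x y 1 = x := rfl
theorem sideLength_two : sideLength x y 2 = Real.goldenRatio * x + y := rfl
theorem sideLength_three : sideLength x y 3 = Real.goldenRatio * (x + y) := rfl
theorem sideLength_four : sideLength x y 4 = x + Real.goldenRatio * y := rfl

end values

/-- Time reversal followed by the central symmetry that exchanges the two pentagons preserves the
direction and changes the sign of the heights. -/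
theorem HeightStep.reverse {X M : ZMod 5 → ℝ} {s t : ZMod 5 × ℝ} (h : HeightStep X M s t) :
    HeightStep X M (t.1, -t.2) (s.1, -s.2) := by
  rcases h with ⟨h1, h2, h3, h4, h5, h6, h7⟩ | ⟨h1, h2, h3, h4, h5, h6, h7⟩
  · right; refine ⟨h2, h1, ?_, ?_, ?_, ?_, ?_⟩ <;> simp only <;> linarith
  · left; refine ⟨h2, h1, ?_, ?_, ?_, ?_, ?_⟩ <;> simp only <;> linarith

/-- A step in a direction outside the sector `0`, between the pentagons in one of the two possible
orders, rises on the path `0, 2, 3, 4, 1`, and its reflection crosses the sides between. -/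
theorem HeightStep.rise {x y : ℝ} (hx : 0 ≤ x) (hy : 0 ≤ y) {c d : ZMod 5} {η η' : ℝ}
    (h : HeightStep (sideHeight (-x) y) (midHeight (-x) y) (c, η) (d, η'))
    (hc : sideHeight (-x) y c < 0) :
    walkPos c < walkPos d ∧ ∀ e, walkPos c ≤ walkPos e → walkPos e ≤ walkPos d →
      -sideLength x y e < -η + (midHeight (-x) y e - midHeight (-x) y c) ∧
        -η + (midHeight (-x) y e - midHeight (-x) y c) < sideLength x y e := by
  obtain ⟨hx1, hx2⟩ := goldenRatio_mul_bounds hx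
  obtain ⟨hy1, hy2⟩ := goldenRatio_mul_bounds hy
  rcases h with ⟨h1, h2, h3, h4, h5, h6, h7⟩ | ⟨h1, -⟩
  swap
  · exact absurd h1 hc.not_gt
  clear hc
  simp only at h1 h2 h3 h4 h5 h6 h7
  rcases label_cases c with rfl | rfl | rfl | rfl | rfl <;>
  simp only [sideHeight_zero, sideHeight_one, sideHeight_two, sideHeight_three,
    sideHeight_four] at h1 h3 h4 <;>
  first
  | (exfalso; linarith)
  | (rcases label_cases d with rfl | rfl | rfl | rfl | rfl <;>
    simp only [sideHeight_zero, sideHeight_one, sideHeight_two, sideHeight_three,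
    sideHeight_four, midHeight_zero, midHeight_one, midHeight_two, midHeight_three,
    midHeight_four] at h2 h5 h6 h7 <;>
    first
    | (exfalso; linarith)
    | (refine ⟨by decide, fun e he he' => ?_⟩
       rcases label_cases e with rfl | rfl | rfl | rfl | rfl <;>
       first
       | exact absurd he (by decide)
       | exact absurd he' (by decide)
       | (simp only [sideLength_zero, sideLength_one, sideLength_two, sideLength_three,
    sideLength_four, midHeight_zero, midHeight_one, midHeight_two, midHeight_three,
    midHeight_four]
          constructor <;> linarith)))

/-- In a direction of the sector `0`, a line that crosses two consecutive sides of the path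
`0, 2, 3, 4, 1` makes a step between them. -/
theorem heightStep_of_adjacent {x y : ℝ} (hx : 0 ≤ x) (hy : 0 ≤ y) {c d : ZMod 5} {η η' : ℝ}
    (hcd : walkPos d = walkPos c + 1) (hη : η' = η + (midHeight (-x) y d - midHeight (-x) y c))
    (hc : -sideLength x y c < η ∧ η < sideLength x y c)
    (hd : -sideLength x y d < η' ∧ η' < sideLength x y d) :
    HeightStep (sideHeight x y) (midHeight x y) (c, η) (d, η') := by
  obtain ⟨hx1, hx2⟩ := goldenRatio_mul_bounds hx
  obtain ⟨hy1, hy2⟩ := goldenRatio_mul_bounds hy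
  obtain ⟨h1, h2⟩ := hc
  obtain ⟨h3, h4⟩ := hd
  rcases label_cases c with rfl | rfl | rfl | rfl | rfl <;>
  rcases label_cases d with rfl | rfl | rfl | rfl | rfl <;>
  first
  | exact absurd hcd (by decide)
  | (clear hcd
     simp only [sideLength_zero, sideLength_one, sideLength_two, sideLength_three,
       sideLength_four, midHeight_zero, midHeight_one, midHeight_two, midHeight_three,
       midHeight_four] at h1 h2 h3 h4 hη
     first
     | (refine Or.inl ⟨?_, ?_, ?_, ?_, ?_, ?_, ?_⟩ <;>
         simp only [sideHeight_zero, sideHeight_one, sideHeight_two, sideHeight_three,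
           sideHeight_four, midHeight_zero, midHeight_one, midHeight_two, midHeight_three,
           midHeight_four] <;> linarith)
     | (refine Or.inr ⟨?_, ?_, ?_, ?_, ?_, ?_, ?_⟩ <;>
         simp only [sideHeight_one, sideHeight_two, sideHeight_three,
           sideHeight_four,
           midHeight_one, midHeight_two, midHeight_three, midHeight_four] <;> linarith))

theorem exists_between₀ : ∀ c d : ZMod 5, walkPos c < walkPos d →
    List.IsChain (fun e f => walkPos f = walkPos e + 1 ∧ walkPos c ≤ walkPos e ∧
      walkPos f ≤ walkPos d) (c :: (between₀ c d ++ [d])) := by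
  decide

theorem between₀_reverse : ∀ c d : ZMod 5, c ≠ d → (between₀ c d).reverse = between₀ d c := by
  decide

/-- The heights telescope along the straight walk from `c` to `d`, and by `HeightStep.rise` each of
them lies inside the side it belongs to; so every neighbouring pair is a genuine step. -/
theorem HeightStep.isChain {x y : ℝ} (hx : 0 ≤ x) (hy : 0 ≤ y) {c d : ZMod 5} {η η' : ℝ}
    (h : HeightStep (sideHeight (-x) y) (midHeight (-x) y) (c, η) (d, η'))
    (hc : sideHeight (-x) y c < 0) :
    List.IsChain (fun e f => HeightStep (sideHeight x y) (midHeight x y)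
      (e, -η + (midHeight (-x) y e - midHeight (-x) y c))
      (f, -η + (midHeight (-x) y f - midHeight (-x) y c))) (c :: (between₀ c d ++ [d])) := by
  obtain ⟨h1, h2⟩ := h.rise hx hy hc
  refine (exists_between₀ c d h1).imp fun e f hef => ?_
  exact heightStep_of_adjacent hx hy hef.1 (by ring) (h2 e hef.2.1 (by omega))
    (h2 f (by omega) hef.2.2)

/-- The reflection of a step is a path of steps. -/
theorem HeightStep.isPath {x y : ℝ} (hx : 0 ≤ x) (hy : 0 ≤ y) {s t : ZMod 5 × ℝ}
    (h : HeightStep (sideHeight (-x) y) (midHeight (-x) y) s t) :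
    IsPath (HeightStep (sideHeight x y) (midHeight x y)) (s.1, -s.2) (s.1 :: between₀ s.1 t.1)
      (t.1, -t.2) := by
  obtain ⟨c, η⟩ := s
  obtain ⟨d, η'⟩ := t
  have h' := h
  rcases h' with ⟨h1, h2, -, -, -, -, h7⟩ | ⟨h1, h2, -, -, -, -, h7⟩
  · have key := isPath_of_isChain (v := fun e => -η + (midHeight (-x) y e - midHeight (-x) y c))
      (h.isChain hx hy h1)
    convert key using 2
    · simp
    · simp only at h7 ⊢; linarith
  · have key := h.reverse.isChain hx hy h2
    have hne : d ≠ c := by rintro rfl; exact (h1.trans h2).false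
    rw [← List.isChain_reverse] at key
    have e : (d :: (between₀ d c ++ [c])).reverse = c :: (between₀ c d ++ [d]) := by
      simp [between₀_reverse d c hne]
    simp only at key
    rw [e] at key
    have key2 := isPath_of_isChain (R := HeightStep (sideHeight x y) (midHeight x y))
      (v := fun e => -(- -η' + (midHeight (-x) y e - midHeight (-x) y d)))
      (key.imp fun e f hef => hef.reverse)
    convert key2 using 2
    · simp only at h7 ⊢; linarith
    · simp

theorem between_zero (c d : ZMod 5) : between 0 c d = between₀ c d := by
  simp [between]

theorem HeightStep.inside {x y : ℝ} (hx : 0 ≤ x) (hy : 0 ≤ y) {s t : ZMod 5 × ℝ}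
    (h : HeightStep (sideHeight x y) (midHeight x y) s t) :
    (-sideLength x y s.1 < s.2 ∧ s.2 < sideLength x y s.1) ∧
      (-sideLength x y t.1 < t.2 ∧ t.2 < sideLength x y t.1) := by
  have key : ∀ c : ZMod 5, sideHeight x y c ≤ sideLength x y c ∧
      -sideHeight x y c ≤ sideLength x y c := by
    obtain ⟨hx1, hx2⟩ := goldenRatio_mul_bounds hx
    obtain ⟨hy1, hy2⟩ := goldenRatio_mul_bounds hy
    intro c
    rcases label_cases c with rfl | rfl | rfl | rfl | rfl <;>
    simp only [sideHeight_zero, sideHeight_one, sideHeight_two, sideHeight_three, sideHeight_four,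
      sideLength_zero, sideLength_one, sideLength_two, sideLength_three, sideLength_four] <;>
    constructor <;> linarith
  have k1 := key s.1
  have k2 := key t.1
  rcases h with ⟨h1, h2, h3, h4, h5, h6, h7⟩ | ⟨h1, h2, h3, h4, h5, h6, h7⟩ <;>
  exact ⟨⟨by linarith, by linarith⟩, ⟨by linarith, by linarith⟩⟩

/-- With `Δ` the height difference of the midpoints, the two crossings of the lower neighbour put
both `η - Δ` and `η + Δ` inside it, so `|η| < sideLength x y c - |Δ|`. This bound is exactly the
height of `d` in the reflected direction: the places where the walk can turn are the crossings of
the reflected trajectory. -/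
theorem highTurn {x y : ℝ} (hx : 0 ≤ x) (hy : 0 ≤ y) {c d : ZMod 5} {η₁ η η₂ : ℝ}
    (hcd : walkPos d = walkPos c + 1)
    (e₁ : η = η₁ + (midHeight (-x) y d - midHeight (-x) y c))
    (e₂ : η₂ = η - (midHeight (-x) y c - midHeight (-x) y d))
    (h₁ : -sideLength x y c < η₁ ∧ η₁ < sideLength x y c)
    (h : -sideLength x y d < η ∧ η < sideLength x y d)
    (h₂ : -sideLength x y c < η₂ ∧ η₂ < sideLength x y c) :
    0 < sideHeight (-x) y d ∧ -sideHeight (-x) y d < η ∧ η < sideHeight (-x) y d := by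
  obtain ⟨hx1, hx2⟩ := goldenRatio_mul_bounds hx
  obtain ⟨hy1, hy2⟩ := goldenRatio_mul_bounds hy
  rcases label_cases c with rfl | rfl | rfl | rfl | rfl <;>
  rcases label_cases d with rfl | rfl | rfl | rfl | rfl <;>
  first
  | exact absurd hcd (by decide)
  | (clear hcd
     simp only [sideLength_zero, sideLength_one, sideLength_two, sideLength_three, sideLength_four,
       midHeight_zero, midHeight_one, midHeight_two, midHeight_three, midHeight_four,
       sideHeight_one, sideHeight_two, sideHeight_three, sideHeight_four] at e₁ e₂ h h₁ h₂ ⊢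
     refine ⟨?_, ?_, ?_⟩ <;> linarith)

theorem lowTurn {x y : ℝ} (hx : 0 ≤ x) (hy : 0 ≤ y) {c d : ZMod 5} {η₁ η η₂ : ℝ}
    (hcd : walkPos d = walkPos c + 1)
    (e₁ : η = η₁ - (midHeight (-x) y c - midHeight (-x) y d))
    (e₂ : η₂ = η + (midHeight (-x) y d - midHeight (-x) y c))
    (h₁ : -sideLength x y d < η₁ ∧ η₁ < sideLength x y d)
    (h : -sideLength x y c < η ∧ η < sideLength x y c)
    (h₂ : -sideLength x y d < η₂ ∧ η₂ < sideLength x y d) :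
    sideHeight (-x) y c < 0 ∧ sideHeight (-x) y c < η ∧ η < -sideHeight (-x) y c := by
  obtain ⟨hx1, hx2⟩ := goldenRatio_mul_bounds hx
  obtain ⟨hy1, hy2⟩ := goldenRatio_mul_bounds hy
  rcases label_cases c with rfl | rfl | rfl | rfl | rfl <;>
  rcases label_cases d with rfl | rfl | rfl | rfl | rfl <;>
  first
  | exact absurd hcd (by decide)
  | (clear hcd
     simp only [sideLength_zero, sideLength_one, sideLength_two, sideLength_three, sideLength_four,
       midHeight_zero, midHeight_one, midHeight_two, midHeight_three, midHeight_four,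
       sideHeight_zero, sideHeight_two, sideHeight_three, sideHeight_four] at e₁ e₂ h h₁ h₂ ⊢
     refine ⟨?_, ?_, ?_⟩ <;> linarith)

/-- The walk has risen from its last turning point `r` to `s`. -/
def Rising (x y : ℝ) (r s : ZMod 5 × ℝ) : Prop :=
  (sideHeight (-x) y r.1 < 0 ∧ sideHeight (-x) y r.1 < r.2 ∧ r.2 < -sideHeight (-x) y r.1) ∧
    walkPos r.1 < walkPos s.1 ∧ s.2 = r.2 + (midHeight (-x) y s.1 - midHeight (-x) y r.1) ∧
    ∀ e, walkPos s.1 = walkPos e + 1 →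
      -sideLength x y e < r.2 + (midHeight (-x) y e - midHeight (-x) y r.1) ∧
        r.2 + (midHeight (-x) y e - midHeight (-x) y r.1) < sideLength x y e

/-- The walk has fallen from its last turning point `r` to `s`. -/
def Falling (x y : ℝ) (r s : ZMod 5 × ℝ) : Prop :=
  (0 < sideHeight (-x) y r.1 ∧ -sideHeight (-x) y r.1 < r.2 ∧ r.2 < sideHeight (-x) y r.1) ∧
    walkPos s.1 < walkPos r.1 ∧ s.2 = r.2 - (midHeight (-x) y s.1 - midHeight (-x) y r.1) ∧
    ∀ e, walkPos e = walkPos s.1 + 1 →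
      -sideLength x y e < r.2 - (midHeight (-x) y e - midHeight (-x) y r.1) ∧
        r.2 - (midHeight (-x) y e - midHeight (-x) y r.1) < sideLength x y e

theorem walkPos_injective : Function.Injective walkPos := by decide

theorem between₀_of_rise : ∀ c d e : ZMod 5, walkPos c < walkPos d → walkPos e = walkPos d + 1 →
    between₀ c e = between₀ c d ++ [d] := by decide

theorem between₀_of_fall : ∀ c d e : ZMod 5, walkPos d < walkPos c → walkPos e + 1 = walkPos d →
    between₀ c e = between₀ c d ++ [d] := by decide

theorem between₀_of_adjacent : ∀ c d : ZMod 5,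
    walkPos d = walkPos c + 1 ∨ walkPos d + 1 = walkPos c →
    between₀ c d = [] := by decide

/-- The walk has gone straight from its last turning point `r` to `s`. -/
def Running (x y : ℝ) (r s : ZMod 5 × ℝ) : Prop := Rising x y r s ∨ Falling x y r s

/-- A run between two turning points has both ends inside the reflected sides, and its telescoped
height difference is that of one step. The reflection reverses orientation, hence the negated
heights. -/
theorem Rising.heightStep {x y : ℝ} {r s : ZMod 5 × ℝ} (h : Rising x y r s)
    (hs : 0 < sideHeight (-x) y s.1 ∧ -sideHeight (-x) y s.1 < s.2 ∧ s.2 < sideHeight (-x) y s.1) :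
    HeightStep (sideHeight (-x) y) (midHeight (-x) y) (r.1, -r.2) (s.1, -s.2) := by
  obtain ⟨⟨h1, h2, h3⟩, -, h5, -⟩ := h
  obtain ⟨h6, h7, h8⟩ := hs
  left
  refine ⟨h1, h6, ?_, ?_, ?_, ?_, ?_⟩ <;> simp only <;> linarith

theorem Falling.heightStep {x y : ℝ} {r s : ZMod 5 × ℝ} (h : Falling x y r s)
    (hs : sideHeight (-x) y s.1 < 0 ∧ sideHeight (-x) y s.1 < s.2 ∧ s.2 < -sideHeight (-x) y s.1) :
    HeightStep (sideHeight (-x) y) (midHeight (-x) y) (r.1, -r.2) (s.1, -s.2) := by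
  obtain ⟨⟨h1, h2, h3⟩, -, h5, -⟩ := h
  obtain ⟨h6, h7, h8⟩ := hs
  right
  refine ⟨h1, h6, ?_, ?_, ?_, ?_, ?_⟩ <;> simp only <;> linarith

/-- A run either goes on or turns, and in the latter case it is the reflection of a step. -/
theorem Running.step {x y : ℝ} (hx : 0 ≤ x) (hy : 0 ≤ y) {r s n : ZMod 5 × ℝ}
    (hr : Running x y r s) (h : HeightStep (sideHeight x y) (midHeight x y) s n) :
    (Running x y r n ∧ between₀ r.1 n.1 = between₀ r.1 s.1 ++ [s.1]) ∨
      (HeightStep (sideHeight (-x) y) (midHeight (-x) y) (r.1, -r.2) (s.1, -s.2) ∧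
        Running x y s n ∧ between₀ s.1 n.1 = []) := by
  obtain ⟨hs, hn⟩ := h.inside hx hy
  rcases hr with hr | hr <;> rcases h.walk hx hy with ⟨w1, w2⟩ | ⟨w1, w2⟩
  · obtain ⟨h1, h2, h3, h4⟩ := hr
    refine .inl ⟨.inl ⟨h1, by omega, by rw [w2, h3]; ring, fun e he => ?_⟩,
      between₀_of_rise _ _ _ h2 w1⟩
    have : e = s.1 := walkPos_injective (by omega)
    rw [this, ← h3]; exact hs
  · have hr' := hr
    obtain ⟨h1, h2, h3, h4⟩ := hr'
    have b := h4 n.1 (by omega)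
    have ht := highTurn hx hy (c := n.1) (d := s.1) (η₁ := r.2 +
      (midHeight (-x) y n.1 - midHeight (-x) y r.1)) (η := s.2) (η₂ := n.2) (by omega)
      (by rw [h3]; ring) w2 b hs hn
    refine .inr ⟨hr.heightStep ht, .inr ⟨ht, by omega, w2, fun e he => ?_⟩,
      between₀_of_adjacent _ _ (.inr w1)⟩
    have : e = s.1 := walkPos_injective (by omega)
    rw [this]; simpa using hs
  · have hr' := hr
    obtain ⟨h1, h2, h3, h4⟩ := hr'
    have b := h4 n.1 (by omega)
    have ht := lowTurn hx hy (c := s.1) (d := n.1) (η₁ := r.2 -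
      (midHeight (-x) y n.1 - midHeight (-x) y r.1)) (η := s.2) (η₂ := n.2) (by omega)
      (by rw [h3]; ring) w2 b hs hn
    refine .inr ⟨hr.heightStep ht, .inl ⟨ht, by omega, w2, fun e he => ?_⟩,
      between₀_of_adjacent _ _ (.inl w1)⟩
    have : e = s.1 := walkPos_injective (by omega)
    rw [this]; simpa using hs
  · obtain ⟨h1, h2, h3, h4⟩ := hr
    refine .inl ⟨.inr ⟨h1, by omega, by rw [w2, h3]; ring, fun e he => ?_⟩,
      between₀_of_fall _ _ _ h2 w1⟩
    have : e = s.1 := walkPos_injective (by omega)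
    rw [this, ← h3]; exact hs

/-- A walk is the reflection of a path of steps, followed by a run. -/
theorem Running.exists_isPath {x y : ℝ} (hx : 0 ≤ x) (hy : 0 ≤ y) {l : List (ZMod 5)}
    {r s t : ZMod 5 × ℝ} (hr : Running x y r s)
    (h : IsPath (HeightStep (sideHeight x y) (midHeight x y)) s l t) :
    ∃ r' l', IsPath (HeightStep (sideHeight (-x) y) (midHeight (-x) y)) (r.1, -r.2) l'
        (r'.1, -r'.2) ∧ Running x y r' t ∧
      r.1 :: (between₀ r.1 s.1 ++ l) = insertWalks 0 l' r'.1 ++ r'.1 :: between₀ r'.1 t.1 := by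
  induction l generalizing r s with
  | nil =>
    obtain rfl : s = t := h
    exact ⟨r, [], rfl, hr, by simp [insertWalks]⟩
  | cons c l ih =>
    obtain ⟨rfl, n, h1, h2⟩ := h
    rcases hr.step hx hy h1 with ⟨hr', hb⟩ | ⟨hstep, hr', hb⟩
    · obtain ⟨r', l', h3, h4, h5⟩ := ih hr' h2
      exact ⟨r', l', h3, h4, by rw [← h5, hb]; simp⟩
    · obtain ⟨r', l', h3, h4, h5⟩ := ih hr' h2
      refine ⟨r', r.1 :: l', ⟨rfl, _, hstep, h3⟩, h4, ?_⟩
      rw [hb, List.nil_append] at h5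
      rw [insertWalks, h3.headD_eq, between_zero, h5]
      simp

theorem isPath_mem {R : ZMod 5 × ℝ → ZMod 5 × ℝ → Prop} {l : List (ZMod 5)} {s t : ZMod 5 × ℝ}
    (h : IsPath R s l t) (hl : l ≠ []) : s.1 ∈ l := by
  cases l with
  | nil => exact absurd rfl hl
  | cons c l => rw [h.1]; simp

/-- The reflection of a loop is a loop. -/
theorem IsLoop.substitute {x y : ℝ} (hx : 0 ≤ x) (hy : 0 ≤ y) {l : List (ZMod 5)}
    (h : IsLoop (HeightStep (sideHeight (-x) y) (midHeight (-x) y)) l) :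
    IsLoop (HeightStep (sideHeight x y) (midHeight x y)) (substitute 0 l) := by
  obtain ⟨hl, s, hs⟩ := h
  have key : ∀ {l s t}, IsPath (HeightStep (sideHeight (-x) y) (midHeight (-x) y)) s l t →
      IsPath (HeightStep (sideHeight x y) (midHeight x y)) (s.1, -s.2) (insertWalks 0 l t.1)
        (t.1, -t.2) := by
    intro l
    induction l with
    | nil => intro s t h; rw [show s = t from h]; rfl
    | cons c l ih =>
      rintro s t ⟨rfl, s', h1, h2⟩
      rw [insertWalks, h2.headD_eq, between_zero, ← List.cons_append]
      exact (h1.isPath hx hy).append (ih h2)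
  refine ⟨substitute_ne_nil 0 hl, (s.1, -s.2), ?_⟩
  rw [substitute_eq 0 l s.1, hs.headD_eq]
  exact key hs

/-- Every loop in a direction of the sector `0` is the reflection of a loop. -/
theorem IsLoop.exists_substitute {x y : ℝ} (hx : 0 ≤ x) (hy : 0 ≤ y) {l : List (ZMod 5)}
    (h : IsLoop (HeightStep (sideHeight x y) (midHeight x y)) l) :
    ∃ l', IsLoop (HeightStep (sideHeight (-x) y) (midHeight (-x) y)) l' ∧
      l ~r _root_.substitute 0 l' := by
  -- The loop is cut at a letter lowest on the path. The walk has to turn there, so no run is broken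
  -- by the cut.
  obtain ⟨c, hc, hmin⟩ := l.toFinset.exists_min_image walkPos
    (by rw [List.toFinset_nonempty_iff]; exact h.1)
  rw [List.mem_toFinset] at hc
  obtain ⟨l₁, l₂, rfl⟩ := List.mem_iff_append.mp hc
  have hrot : l₁ ++ c :: l₂ ~r c :: l₂ ++ l₁ := List.isRotated_append
  have h' := h.isRotated hrot
  have hmin' : ∀ e ∈ c :: (l₂ ++ l₁), walkPos c ≤ walkPos e := by
    intro e he
    refine hmin e ?_
    simp only [List.mem_toFinset, List.mem_append, List.mem_cons] at he ⊢
    tauto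
  obtain ⟨-, r, hr⟩ := h'
  rw [List.cons_append] at hr
  obtain ⟨hrc, n, hn, hpath⟩ := hr
  subst hrc
  suffices H : ∃ l', IsLoop (HeightStep (sideHeight (-x) y) (midHeight (-x) y)) l' ∧
      r.1 :: (l₂ ++ l₁) ~r _root_.substitute 0 l' by
    obtain ⟨l', h1, h2⟩ := H
    exact ⟨l', h1, hrot.trans h2⟩
  clear hmin hrot hc h
  generalize l₂ ++ l₁ = l at *
  have hl : l ≠ [] := by
    rintro rfl
    obtain rfl : n = r := hpath
    rcases hn.walk hx hy with ⟨w, -⟩ | ⟨w, -⟩ <;> omega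
  have hup : walkPos n.1 = walkPos r.1 + 1 ∧
      n.2 = r.2 + (midHeight (-x) y n.1 - midHeight (-x) y r.1) := by
    rcases hn.walk hx hy with w | ⟨w, -⟩
    · exact w
    · have := hmin' n.1 (List.mem_cons_of_mem _ (isPath_mem hpath hl))
      omega
  have hlow : sideHeight (-x) y r.1 < 0 ∧ sideHeight (-x) y r.1 < r.2 ∧
      r.2 < -sideHeight (-x) y r.1 := by
    rcases List.eq_nil_or_concat l with rfl | ⟨l', e, rfl⟩
    · exact absurd rfl hl
    rw [List.concat_eq_append] at hpath hmin'
    obtain ⟨p, -, hpe, s', hps, hs'⟩ := isPath_append.mp hpath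
    obtain rfl : s' = r := hs'
    have hpos := hmin' p.1 (by rw [hpe]; simp)
    rcases hps.walk hx hy with ⟨w, -⟩ | ⟨w, w'⟩
    · omega
    have hnp : n.1 = p.1 := walkPos_injective (by omega)
    obtain ⟨b1, b2⟩ := hn.inside hx hy
    refine lowTurn hx hy (d := p.1) w.symm w' ?_ (hps.inside hx hy).1 b1 (hnp ▸ b2)
    rw [← hnp]
    exact hup.2
  have hrun : Running x y r n := by
    refine .inl ⟨hlow, by omega, hup.2, fun e he => ?_⟩
    have : e = r.1 := walkPos_injective (by omega)
    rw [this]; simpa using (hn.inside hx hy).1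
  obtain ⟨r', l', h3, h4, h5⟩ := hrun.exists_isPath hx hy hpath
  rw [between₀_of_adjacent _ _ (.inl hup.1), List.nil_append] at h5
  rcases h4 with h4 | h4
  -- A rising run would start below the lowest letter. So the last run falls, and it ends in the low
  -- turn at the cut.
  · have := hmin' r'.1 (by rw [h5]; simp)
    have := h4.2.1
    omega
  · have hlast := h4.heightStep hlow
    have hp := h3.append (l₂ := [r'.1]) ⟨rfl, _, hlast, rfl⟩
    refine ⟨l' ++ [r'.1], ⟨by simp, _, hp⟩, ?_⟩
    rw [substitute_eq 0 _ r.1, hp.headD_eq, insertWalks_append, h5]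
    simp only [insertWalks, between_zero, List.headD_nil, List.append_nil]
    exact List.IsRotated.refl _

/-! ## Displacements -/

/-- The sum of `f` over the transitions of the word `l`, followed by the letter `t`. -/
def edgeSum (f : ZMod 5 → ZMod 5 → ℝ) : List (ZMod 5) → ZMod 5 → ℝ
  | [], _ => 0
  | c :: l, t => f c (l.headD t) + edgeSum f l t

theorem edgeSum_append (f : ZMod 5 → ZMod 5 → ℝ) (l₁ l₂ : List (ZMod 5)) (t : ZMod 5) :
    edgeSum f (l₁ ++ l₂) t = edgeSum f l₁ (l₂.headD t) + edgeSum f l₂ t := by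
  induction l₁ with
  | nil => simp [edgeSum]
  | cons c l ih => simp [edgeSum, ih, add_assoc]

/-- The sum of `f` over the transitions of a cyclic word. -/
def cycleSum (f : ZMod 5 → ZMod 5 → ℝ) (l : List (ZMod 5)) : ℝ := edgeSum f l (l.headD 0)

theorem cycleSum_eq (f : ZMod 5 → ZMod 5 → ℝ) (l : List (ZMod 5)) (t : ZMod 5) :
    cycleSum f l = edgeSum f l (l.headD t) := by
  cases l <;> rfl

theorem cycleSum_append (f : ZMod 5 → ZMod 5 → ℝ) (l₁ l₂ : List (ZMod 5)) (t : ZMod 5) :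
    cycleSum f (l₁ ++ l₂) =
      edgeSum f l₁ (l₂.headD (l₁.headD t)) + edgeSum f l₂ (l₁.headD (l₂.headD t)) := by
  rw [cycleSum_eq f _ t, edgeSum_append, headD_append]
  rcases l₁ with _ | ⟨c, l₁⟩ <;> rcases l₂ with _ | ⟨d, l₂⟩ <;> rfl

theorem cycleSum_isRotated (f : ZMod 5 → ZMod 5 → ℝ) {l l' : List (ZMod 5)} (h : l ~r l') :
    cycleSum f l = cycleSum f l' := by
  obtain ⟨n, hn, rfl⟩ := List.isRotated_iff_mod.mp h
  rw [List.rotate_eq_drop_append_take hn]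
  conv_lhs => rw [← List.take_append_drop n l]
  rw [cycleSum_append f _ _ 0, cycleSum_append f _ _ 0, add_comm]

theorem cycleSum_wordPow (f : ZMod 5 → ZMod 5 → ℝ) (l : List (ZMod 5)) (n : ℕ) :
    cycleSum f (wordPow l n) = n * cycleSum f l := by
  rcases l with _ | ⟨c, l⟩
  · simp [wordPow, cycleSum, edgeSum]
  induction n with
  | zero => simp [cycleSum, edgeSum]
  | succ n ih =>
    rw [wordPow_succ, cycleSum_append f _ _ c]
    rcases n with _ | n
    · simp [cycleSum, edgeSum]
    · rw [cycleSum_eq f _ c] at ih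
      have e : (wordPow (c :: l) (n + 1)).headD c = c := by rw [wordPow_succ]; rfl
      rw [e] at ih
      rw [List.headD_cons, e, List.headD_cons, ih, cycleSum_eq f _ c, List.headD_cons]
      push_cast
      ring

theorem edgeSum_map {f : ZMod 5 → ZMod 5 → ℝ} {g : ZMod 5 → ZMod 5} (l : List (ZMod 5))
    (t : ZMod 5) :
    edgeSum f (l.map g) (g t) = edgeSum (fun c d => f (g c) (g d)) l t := by
  induction l with
  | nil => rfl
  | cons c l ih =>
    have : (l.map g).headD (g t) = g (l.headD t) := by cases l <;> rfl
    rw [List.map_cons, edgeSum, ih, this, edgeSum]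

theorem edgeSum_of_isChain {f : ZMod 5 → ZMod 5 → ℝ} {g : ZMod 5 → ℝ} {c d : ZMod 5}
    {l : List (ZMod 5)} (h : List.IsChain (fun a b => f a b = g b - g a) (c :: (l ++ [d]))) :
    edgeSum f (c :: l) d = g d - g c := by
  induction l generalizing c with
  | nil => simpa [edgeSum] using h
  | cons e l ih =>
    rw [List.cons_append, List.isChain_cons_cons] at h
    rw [edgeSum, ih h.2, List.headD_cons, h.1]
    ring

/-- The displacement between the midpoints of two consecutive sides, measured by `N`. -/
noncomputable def displacement (X N : ZMod 5 → ℝ) (c d : ZMod 5) : ℝ :=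
  if 0 < X d then N d - N c else -(N d - N c)

/-- Along the path `0, 2, 3, 4, 1` the exits alternate between the two pentagons, and the
alternating signs turn midpoint differences for `(a, b)` into differences for `(-a, b)`. The
measuring vector is independent of the direction `(x, y)`. -/
theorem displacement_of_adjacent {x y : ℝ} (hx : 0 ≤ x) (hy : 0 ≤ y) (hxy : 0 < x + y) (a b : ℝ)
    {c d : ZMod 5} (hcd : walkPos d = walkPos c + 1) :
    displacement (sideHeight x y) (midHeight a b) c d =
        -midHeight (-a) b d - -midHeight (-a) b c ∧
      displacement (sideHeight x y) (midHeight a b) d c =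
        midHeight (-a) b c - midHeight (-a) b d := by
  obtain ⟨hx1, hx2⟩ := goldenRatio_mul_bounds hx
  obtain ⟨hy1, hy2⟩ := goldenRatio_mul_bounds hy
  have p0 : ¬ 0 < sideHeight x y 0 := by rw [sideHeight_zero]; linarith
  have p1 : ¬ 0 < sideHeight x y 1 := by rw [sideHeight_one]; linarith
  have p2 : 0 < sideHeight x y 2 := by rw [sideHeight_two]; linarith
  have p3 : ¬ 0 < sideHeight x y 3 := by rw [sideHeight_three]; linarith
  have p4 : 0 < sideHeight x y 4 := by rw [sideHeight_four]; linarith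
  rcases label_cases c with rfl | rfl | rfl | rfl | rfl <;>
  rcases label_cases d with rfl | rfl | rfl | rfl | rfl <;>
  first
  | exact absurd hcd (by decide)
  | (simp only [displacement, if_pos p2, if_pos p4, if_neg p0, if_neg p1, if_neg p3,
      midHeight_zero, midHeight_one, midHeight_two, midHeight_three, midHeight_four]
     constructor <;> ring)

theorem HeightStep.edgeSum_eq {x y : ℝ} (hx : 0 ≤ x) (hy : 0 ≤ y) (hxy : 0 < x + y) (a b : ℝ)
    {s t : ZMod 5 × ℝ} (h : HeightStep (sideHeight (-x) y) (midHeight (-x) y) s t) :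
    edgeSum (displacement (sideHeight x y) (midHeight a b)) (s.1 :: between₀ s.1 t.1) t.1 =
      -displacement (sideHeight (-x) y) (midHeight (-a) b) s.1 t.1 := by
  have h' := h
  rcases h' with ⟨h1, h2, -⟩ | ⟨h1, h2, -⟩
  · have key := edgeSum_of_isChain (g := fun e => -midHeight (-a) b e)
      ((exists_between₀ s.1 t.1 (h.rise hx hy h1).1).imp fun e f hef =>
        (displacement_of_adjacent hx hy hxy a b hef.1).1)
    rw [key, displacement, if_pos h2]
    ring
  · have hp := (h.reverse.rise hx hy h2).1
    have hne : t.1 ≠ s.1 := by intro h; rw [h] at hp; exact hp.false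
    have e : (t.1 :: (between₀ t.1 s.1 ++ [s.1])).reverse = s.1 :: (between₀ s.1 t.1 ++ [t.1]) := by
      simp [between₀_reverse t.1 s.1 hne]
    have hc := exists_between₀ t.1 s.1 hp
    rw [← List.isChain_reverse, e] at hc
    have key := edgeSum_of_isChain (f := displacement (sideHeight x y) (midHeight a b))
      (g := fun e => midHeight (-a) b e)
      (hc.imp fun e f hef => (displacement_of_adjacent hx hy hxy a b hef.1).2)
    rw [key, displacement, if_neg h2.not_gt]
    ring

/-- Since `(a, b)` is arbitrary, this says that the displacement vector of a loop is carried along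
by a fixed linear map; linear relations between displacements of loops are therefore preserved. -/
theorem IsLoop.cycleSum_substitute {x y : ℝ} (hx : 0 ≤ x) (hy : 0 ≤ y) (hxy : 0 < x + y) (a b : ℝ)
    {l : List (ZMod 5)}
    (h : IsLoop (HeightStep (sideHeight (-x) y) (midHeight (-x) y)) l) :
    cycleSum (displacement (sideHeight x y) (midHeight a b)) (_root_.substitute 0 l) =
      -cycleSum (displacement (sideHeight (-x) y) (midHeight (-a) b)) l := by
  obtain ⟨hl, s, hs⟩ := h
  have key : ∀ {l : List (ZMod 5)} {s t},
      IsPath (HeightStep (sideHeight (-x) y) (midHeight (-x) y)) s l t →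
      edgeSum (displacement (sideHeight x y) (midHeight a b)) (insertWalks 0 l t.1) t.1 =
        -edgeSum (displacement (sideHeight (-x) y) (midHeight (-a) b)) l t.1 := by
    intro l
    induction l with
    | nil => intro s t h; simp [insertWalks, edgeSum]
    | cons c l ih =>
      rintro s t ⟨rfl, s', h1, h2⟩
      rw [insertWalks, h2.headD_eq, between_zero, ← List.cons_append, edgeSum_append,
        headD_insertWalks, h2.headD_eq, h1.edgeSum_eq hx hy hxy, ih h2, edgeSum, h2.headD_eq]
      ring
  have e := hs.headD_eq
  rw [cycleSum_eq _ l s.1, cycleSum_eq _ _ s.1, substitute_eq 0 l s.1, e, headD_insertWalks, e]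
  exact key hs

/-! ## Heights in the double pentagon -/

/-- The cross product of two vectors of the plane. -/
def cross (u v : ℂ) : ℝ := u.re * v.im - u.im * v.re

theorem cross_add_right (u v w : ℂ) : cross u (v + w) = cross u v + cross u w := by
  simp [cross]; ring

theorem cross_sub_right (u v w : ℂ) : cross u (v - w) = cross u v - cross u w := by
  simp [cross]; ring

theorem cross_add_left (u v w : ℂ) : cross (u + v) w = cross u w + cross v w := by
  simp [cross]; ring

theorem cross_smul_left (r : ℝ) (u v : ℂ) : cross (r • u) v = r * cross u v := by
  simp [cross]; ring

theorem cross_smul_right (r : ℝ) (u v : ℂ) : cross u (r • v) = r * cross u v := by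
  simp [cross]; ring

theorem cross_self_eq_zero (u : ℂ) : cross u u = 0 := by simp [cross]; ring

theorem cross_mul_mul (r u v : ℂ) : cross (r * u) (r * v) = Complex.normSq r * cross u v := by
  simp [cross, Complex.normSq_apply]; ring

theorem corner_eq_pow (k : ZMod 5) :
    corner k = Complex.exp (2 * Real.pi * Complex.I / 5) ^ k.val := by
  rw [corner, ← Complex.exp_nat_mul]
  congr 1
  ring

theorem exp_pow_five : Complex.exp (2 * Real.pi * Complex.I / 5) ^ 5 = 1 := by
  rw [← Complex.exp_nat_mul, ← Complex.exp_two_pi_mul_I]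
  congr 1
  push_cast
  ring

theorem corner_add (a b : ZMod 5) : corner (a + b) = corner a * corner b := by
  rw [corner_eq_pow, corner_eq_pow, corner_eq_pow, ← pow_add, ZMod.val_add]
  conv_rhs => rw [← Nat.div_add_mod (a.val + b.val) 5, pow_add, pow_mul, exp_pow_five]
  simp

theorem corner_zero : corner 0 = 1 := by simp [corner]

theorem corner_eq_exp (k : ZMod 5) :
    corner k = Complex.exp ((2 * Real.pi * k.val / 5 : ℝ) * Complex.I) := by
  rw [corner]
  congr 1
  push_cast
  ring

theorem normSq_corner (k : ZMod 5) : Complex.normSq (corner k) = 1 := by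
  rw [corner_eq_exp, Complex.normSq_eq_norm_sq, Complex.norm_exp_ofReal_mul_I, one_pow]

theorem corner_two_add_corner_three : corner 2 + corner 3 = -(Real.goldenRatio : ℂ) := by
  have h2 : ((2 : ZMod 5).val : ℝ) = 2 := by norm_cast
  have h3 : ((3 : ZMod 5).val : ℝ) = 3 := by norm_cast
  have e2 : 2 * Real.pi * 2 / 5 = Real.pi - Real.pi / 5 := by ring
  have e3 : 2 * Real.pi * 3 / 5 = Real.pi / 5 + Real.pi := by ring
  have hφ : Real.goldenRatio = 2 * Real.cos (Real.pi / 5) := by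
    rw [Real.cos_pi_div_five, Real.goldenRatio]; ring
  rw [corner_eq_exp, corner_eq_exp, h2, h3, e2, e3, hφ]
  apply Complex.ext
  · rw [Complex.add_re, Complex.exp_ofReal_mul_I_re, Complex.exp_ofReal_mul_I_re,
      Real.cos_pi_sub, Real.cos_add_pi, Complex.neg_re, Complex.ofReal_re]
    ring
  · rw [Complex.add_im, Complex.exp_ofReal_mul_I_im, Complex.exp_ofReal_mul_I_im,
      Real.sin_pi_sub, Real.sin_add_pi, Complex.neg_im, Complex.ofReal_im]
    ring

/-- The side of the regular pentagon as a vector. -/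
noncomputable def sideVec (c : ZMod 5) : ℂ := sideEnd c - sideStart c

theorem sideVec_add (c k : ZMod 5) : sideVec (c + k) = corner (3 * k) * sideVec c := by
  rw [sideVec, sideVec, sideEnd, sideEnd, sideStart, sideStart,
    show 3 * (c + k) + 1 = 3 * k + (3 * c + 1) by ring, show 3 * (c + k) = 3 * k + 3 * c by ring,
    corner_add, corner_add (3 * k) (3 * c)]
  ring

theorem sideNormal_add (c k : ZMod 5) : sideNormal (c + k) = corner (3 * k) * sideNormal c := by
  rw [sideNormal, sideNormal, sideEnd, sideEnd, sideStart, sideStart,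
    show 3 * (c + k) + 1 = 3 * k + (3 * c + 1) by ring, show 3 * (c + k) = 3 * k + 3 * c by ring,
    corner_add (3 * k) (3 * c + 1), corner_add (3 * k) (3 * c)]
  ring

/-- The height of the side `c` above the direction `u`. -/
noncomputable def sideCross (u : ℂ) (c : ZMod 5) : ℝ := cross u (sideVec c)

/-- Twice the height of the midpoint of the side `c` above the direction `u`. -/
noncomputable def normalCross (u : ℂ) (c : ZMod 5) : ℝ := cross u (sideNormal c)

/-- The neighbouring side vectors are obtained by multiplication with `corner 3` and `corner 2`,
whose sum is `-φ`. -/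
theorem sideCross_succ_add (u : ℂ) (c : ZMod 5) :
    sideCross u (c + 1) + sideCross u (c - 1) = -(Real.goldenRatio * sideCross u c) := by
  have h : sideVec (c + 1) + sideVec (c - 1) = (-Real.goldenRatio : ℝ) • sideVec c := by
    rw [sub_eq_add_neg, sideVec_add, sideVec_add, ← add_mul,
      show (3 : ZMod 5) * 1 = 3 by decide, show (3 : ZMod 5) * -1 = 2 by decide, add_comm,
      corner_two_add_corner_three]
    simp
  rw [sideCross, sideCross, ← cross_add_right, h, cross_smul_right, sideCross, neg_mul]

/-- The sides `c` and `c + 2` share a corner of the pentagon, so their midpoints differ by half of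
each side vector. -/
theorem normalCross_add_two (u : ℂ) (c : ZMod 5) :
    normalCross u (c + 2) = normalCross u c + sideCross u c + sideCross u (c + 2) := by
  have h : sideEnd c = sideStart (c + 2) := by
    rw [sideEnd, sideStart, mul_add]; congr 2
  rw [normalCross, normalCross, sideCross, sideCross, ← cross_add_right, ← cross_add_right,
    sideNormal, sideNormal, sideVec, sideVec, h]
  congr 1
  ring

/-- The three-term recurrence of `sideCross_succ_add` determines all heights from those of the sides
`0` and `1`. -/
theorem sideCross_eq (u : ℂ) : sideCross u = sideHeight (-sideCross u 1) (-sideCross u 0) := by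
  have h1 := sideCross_succ_add u 1
  have h2 := sideCross_succ_add u 0
  have h3 := sideCross_succ_add u 2
  simp only [show (1 : ZMod 5) + 1 = 2 by decide, show (1 : ZMod 5) - 1 = 0 by decide,
    show (0 : ZMod 5) + 1 = 1 by decide, show (0 : ZMod 5) - 1 = 4 by decide,
    show (2 : ZMod 5) + 1 = 3 by decide, show (2 : ZMod 5) - 1 = 1 by decide] at h1 h2 h3
  have hφ := Real.goldenRatio_sq
  funext c
  rcases label_cases c with rfl | rfl | rfl | rfl | rfl <;>
  simp only [sideHeight_zero, sideHeight_one, sideHeight_two, sideHeight_three, sideHeight_four]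
  · ring
  · ring
  · linarith
  · linear_combination h3 - Real.goldenRatio * h1 + sideCross u 1 * hφ
  · linarith

theorem normalCross_sub (u : ℂ) (c : ZMod 5) :
    normalCross u c - normalCross u 0 = midHeight (-sideCross u 1) (-sideCross u 0) c := by
  have h0 := normalCross_add_two u 0
  have h2 := normalCross_add_two u 2
  have h4 := normalCross_add_two u 4
  have h1 := normalCross_add_two u 1
  simp only [show (0 : ZMod 5) + 2 = 2 by decide, show (2 : ZMod 5) + 2 = 4 by decide,
    show (4 : ZMod 5) + 2 = 1 by decide, show (1 : ZMod 5) + 2 = 3 by decide] at h0 h1 h2 h4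
  have e := sideCross_eq u
  have e2 := congrFun e 2
  have e3 := congrFun e 3
  have e4 := congrFun e 4
  rw [sideHeight_two] at e2
  rw [sideHeight_three] at e3
  rw [sideHeight_four] at e4
  rcases label_cases c with rfl | rfl | rfl | rfl | rfl <;>
  simp only [midHeight_zero, midHeight_one, midHeight_two, midHeight_three, midHeight_four] <;>
  linarith

theorem HeightStep.congr {X M M' : ZMod 5 → ℝ} (hM : ∀ c, M c - M 0 = M' c - M' 0)
    {s t : ZMod 5 × ℝ} (h : HeightStep X M s t) : HeightStep X M' s t := by
  have h1 := hM s.1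
  have h2 := hM t.1
  rcases h with ⟨h3, h4, h5, h6, h7, h8, h9⟩ | ⟨h3, h4, h5, h6, h7, h8, h9⟩
  · exact .inl ⟨h3, h4, h5, h6, h7, h8, by linarith⟩
  · exact .inr ⟨h3, h4, h5, h6, h7, h8, by linarith⟩

/-- The steps of the trajectories of direction `u`. -/
def UStep (u : ℂ) : ZMod 5 × ℝ → ZMod 5 × ℝ → Prop := HeightStep (sideCross u) (normalCross u)

theorem uStep_eq {u : ℂ} {x y : ℝ} (hx : -sideCross u 1 = x) (hy : -sideCross u 0 = y) :
    UStep u = HeightStep (sideHeight x y) (midHeight x y) := by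
  subst hx hy
  have h : ∀ c, normalCross u c - normalCross u 0 =
      midHeight (-sideCross u 1) (-sideCross u 0) c -
        midHeight (-sideCross u 1) (-sideCross u 0) 0 := by
    intro c; rw [normalCross_sub, midHeight_zero, sub_zero]
  funext s t
  rw [UStep, ← sideCross_eq]
  exact propext ⟨fun k => k.congr h, fun k => k.congr fun c => (h c).symm⟩

theorem displacement_eq {u v : ℂ} {x y a b : ℝ} (hx : -sideCross u 1 = x)
    (hy : -sideCross u 0 = y) (ha : -sideCross v 1 = a) (hb : -sideCross v 0 = b) :
    displacement (sideCross u) (normalCross v) = displacement (sideHeight x y) (midHeight a b) := by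
  subst hx hy ha hb
  funext c d
  rw [displacement, displacement, ← sideCross_eq, ← normalCross_sub, ← normalCross_sub]
  simp

/-! ### The loops of a direction, and changes of its direction vector. -/

/-- The loops of direction `u` are the multiples of `a` and of `A`, up to rotation, and the loop `A`
is longer than the loop `a` by the golden ratio. -/
def HasLoops (u : ℂ) (a A : List (ZMod 5)) : Prop :=
  IsLoop (UStep u) a ∧ IsLoop (UStep u) A ∧
    (∀ l, IsLoop (UStep u) l → ∃ k, 0 < k ∧ (l ~r wordPow a k ∨ l ~r wordPow A k)) ∧
    ∀ v, cycleSum (displacement (sideCross u) (normalCross v)) A =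
      Real.goldenRatio * cycleSum (displacement (sideCross u) (normalCross v)) a

theorem HasLoops.isRotated {u : ℂ} {a A a' A' : List (ZMod 5)} (h : HasLoops u a A)
    (ha : a ~r a') (hA : A ~r A') : HasLoops u a' A' := by
  obtain ⟨h1, h2, h3, h4⟩ := h
  refine ⟨h1.isRotated ha, h2.isRotated hA, fun l hl => ?_, fun v => ?_⟩
  · obtain ⟨k, hk, h | h⟩ := h3 l hl
    · exact ⟨k, hk, .inl (h.trans (wordPow_isRotated ha k))⟩
    · exact ⟨k, hk, .inr (h.trans (wordPow_isRotated hA k))⟩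
  · rw [← cycleSum_isRotated _ ha, ← cycleSum_isRotated _ hA, h4]

theorem IsPath.edgeSum_eq {R : ZMod 5 × ℝ → ZMod 5 × ℝ → Prop} {f g : ZMod 5 → ZMod 5 → ℝ} {κ : ℝ}
    (hfg : ∀ s t, R s t → f s.1 t.1 = κ * g s.1 t.1) {s t : ZMod 5 × ℝ} {l : List (ZMod 5)}
    (h : IsPath R s l t) : edgeSum f l t.1 = κ * edgeSum g l t.1 := by
  induction l generalizing s with
  | nil => simp [edgeSum]
  | cons c l ih =>
    obtain ⟨rfl, s', h1, h2⟩ := h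
    rw [edgeSum, edgeSum, h2.headD_eq, hfg _ _ h1, ih h2]
    ring

theorem IsLoop.cycleSum_eq {R : ZMod 5 × ℝ → ZMod 5 × ℝ → Prop} {f g : ZMod 5 → ZMod 5 → ℝ} {κ : ℝ}
    (hfg : ∀ s t, R s t → f s.1 t.1 = κ * g s.1 t.1) {l : List (ZMod 5)}
    (h : IsLoop R l) : cycleSum f l = κ * cycleSum g l := by
  obtain ⟨-, s, hs⟩ := h
  rw [_root_.cycleSum_eq f l s.1, _root_.cycleSum_eq g l s.1, hs.headD_eq]
  exact hs.edgeSum_eq hfg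

theorem sideCross_smul (r : ℝ) (u : ℂ) (c : ZMod 5) : sideCross (r • u) c = r * sideCross u c :=
  cross_smul_left r u _

theorem normalCross_smul (r : ℝ) (u : ℂ) (c : ZMod 5) :
    normalCross (r • u) c = r * normalCross u c :=
  cross_smul_left r u _

/-- A negative factor exchanges the two pentagons, hence the two alternatives of a step; the heights
above the midpoints are multiplied by `|r|` in both cases. -/
theorem UStep.smul {u : ℂ} {r : ℝ} (hr : r ≠ 0) {s t : ZMod 5 × ℝ} (h : UStep u s t) :
    UStep (r • u) (s.1, |r| * s.2) (t.1, |r| * t.2) := by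
  have e : ∀ z : ZMod 5 × ℝ, (z.1, |r| * z.2).1 = z.1 ∧ (z.1, |r| * z.2).2 = |r| * z.2 :=
    fun z => ⟨rfl, rfl⟩
  rcases lt_or_gt_of_ne hr with hr | hr
  · have hr' : 0 < -r := by linarith
    rcases h with ⟨h3, h4, h5, h6, h7, h8, h9⟩ | ⟨h3, h4, h5, h6, h7, h8, h9⟩
    · right
      simp only [sideCross_smul, normalCross_smul, abs_of_neg hr]
      rw [h9]
      rw [h9] at h7 h8
      refine ⟨?_, ?_, ?_, ?_, ?_, ?_, ?_⟩ <;> nlinarith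
    · left
      simp only [sideCross_smul, normalCross_smul, abs_of_neg hr]
      rw [h9]
      rw [h9] at h7 h8
      refine ⟨?_, ?_, ?_, ?_, ?_, ?_, ?_⟩ <;> nlinarith
  · rcases h with ⟨h3, h4, h5, h6, h7, h8, h9⟩ | ⟨h3, h4, h5, h6, h7, h8, h9⟩
    · left
      simp only [sideCross_smul, normalCross_smul, abs_of_pos hr]
      rw [h9]
      rw [h9] at h7 h8
      refine ⟨?_, ?_, ?_, ?_, ?_, ?_, ?_⟩ <;> nlinarith
    · right
      simp only [sideCross_smul, normalCross_smul, abs_of_pos hr]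
      rw [h9]
      rw [h9] at h7 h8
      refine ⟨?_, ?_, ?_, ?_, ?_, ?_, ?_⟩ <;> nlinarith

theorem IsLoop.smul {u : ℂ} {r : ℝ} (hr : r ≠ 0) {l : List (ZMod 5)} (h : IsLoop (UStep u) l) :
    IsLoop (UStep (r • u)) l := by
  obtain ⟨hl, s, hs⟩ := h
  refine ⟨hl, (id s.1, |r| * s.2), ?_⟩
  have := hs.map (R' := UStep (r • u)) (f := id) (g := fun η => |r| * η) fun s t h => h.smul hr
  simpa using this

theorem HasLoops.smul {u : ℂ} {r : ℝ} (hr : r ≠ 0) {a A : List (ZMod 5)} (h : HasLoops u a A) :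
    HasLoops (r • u) a A := by
  obtain ⟨h1, h2, h3, h4⟩ := h
  refine ⟨h1.smul hr, h2.smul hr, fun l hl => h3 l ?_, fun v => ?_⟩
  · have := hl.smul (inv_ne_zero hr)
    rwa [smul_smul, inv_mul_cancel₀ hr, one_smul] at this
  · have key : ∃ κ : ℝ, ∀ s t, UStep u s t →
        displacement (sideCross (r • u)) (normalCross v) s.1 t.1 =
          κ * displacement (sideCross u) (normalCross v) s.1 t.1 := by
      rcases lt_or_gt_of_ne hr with hr | hr
      · refine ⟨-1, fun s t h => ?_⟩
        rw [displacement, displacement, sideCross_smul]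
        rcases h with ⟨-, h, -⟩ | ⟨-, h, -⟩
        · rw [if_pos h, if_neg (mul_neg_of_neg_of_pos hr h).not_gt]; ring
        · rw [if_neg h.not_gt, if_pos (mul_pos_of_neg_of_neg hr h)]; ring
      · refine ⟨1, fun s t h => ?_⟩
        rw [displacement, displacement, sideCross_smul]
        simp only [mul_pos_iff_of_pos_left hr, one_mul]
    obtain ⟨κ, hκ⟩ := key
    rw [h1.cycleSum_eq hκ, h2.cycleSum_eq hκ, h4]
    ring

/-! ### Rotations -/

theorem sideCross_rotate (u : ℂ) (c k : ZMod 5) :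
    sideCross (corner (3 * k) * u) (c + k) = sideCross u c := by
  rw [sideCross, sideVec_add, cross_mul_mul, normSq_corner, one_mul, sideCross]

theorem normalCross_rotate (u : ℂ) (c k : ZMod 5) :
    normalCross (corner (3 * k) * u) (c + k) = normalCross u c := by
  rw [normalCross, sideNormal_add, cross_mul_mul, normSq_corner, one_mul, normalCross]

theorem corner_mul_corner_neg (k : ZMod 5) (u : ℂ) :
    corner (3 * k) * (corner (3 * -k) * u) = u := by
  rw [← mul_assoc, ← corner_add, ← mul_add, add_neg_cancel, mul_zero, corner_zero, one_mul]

theorem IsLoop.rotate {u : ℂ} (k : ZMod 5) {l : List (ZMod 5)} (h : IsLoop (UStep u) l) :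
    IsLoop (UStep (corner (3 * k) * u)) (l.map (· + k)) := by
  obtain ⟨hl, s, hs⟩ := h
  refine ⟨by simpa using hl, (s.1 + k, s.2), ?_⟩
  refine hs.map (f := (· + k)) (g := id) fun s t h => ?_
  rw [UStep, HeightStep]
  simp only [sideCross_rotate, normalCross_rotate]
  exact h

theorem wordPow_map (f : ZMod 5 → ZMod 5) (l : List (ZMod 5)) (n : ℕ) :
    (wordPow l n).map f = wordPow (l.map f) n := by
  simp [wordPow, List.map_flatten]

theorem cycleSum_map {f : ZMod 5 → ZMod 5 → ℝ} {g : ZMod 5 → ZMod 5} (l : List (ZMod 5)) :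
    cycleSum f (l.map g) = cycleSum (fun c d => f (g c) (g d)) l := by
  rcases l with _ | ⟨c, l⟩
  · rfl
  · exact edgeSum_map (f := f) (g := g) (c :: l) c

theorem HasLoops.rotate {u : ℂ} (k : ZMod 5) {a A : List (ZMod 5)} (h : HasLoops u a A) :
    HasLoops (corner (3 * k) * u) (a.map (· + k)) (A.map (· + k)) := by
  obtain ⟨h1, h2, h3, h4⟩ := h
  refine ⟨h1.rotate k, h2.rotate k, fun l hl => ?_, fun v => ?_⟩
  · have h5 := hl.rotate (-k)
    have h6 := corner_mul_corner_neg (-k) u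
    rw [neg_neg] at h6
    rw [h6] at h5
    have h7 : ((l.map (· + -k)).map (· + k)) = l := by simp [Function.comp_def]
    obtain ⟨n, hn, h | h⟩ := h3 _ h5
    · refine ⟨n, hn, .inl ?_⟩
      rw [← h7, ← wordPow_map]; exact h.map _
    · refine ⟨n, hn, .inr ?_⟩
      rw [← h7, ← wordPow_map]; exact h.map _
  · rw [cycleSum_map, cycleSum_map]
    have e : (fun c d =>
          displacement (sideCross (corner (3 * k) * u)) (normalCross v) (c + k) (d + k))
        = displacement (sideCross u) (normalCross (corner (3 * -k) * v)) := by
      funext c d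
      rw [displacement, displacement, sideCross_rotate, ← normalCross_rotate _ c k,
        ← normalCross_rotate _ d k, corner_mul_corner_neg]
    rw [e]
    exact h4 _

/-! ## Reflections -/

theorem cross_swap (u v : ℂ) : cross u v = -cross v u := by simp [cross]; ring

/-- Cramer's rule in the basis `a`, `b`; reversing the sign of the second component gives the
formula for `reflectMap`. -/
theorem cross_smul_eq (a b u : ℂ) : cross a b • u = cross u b • a - cross u a • b := by
  apply Complex.ext <;> simp [cross] <;> ring

theorem sideCross_add_left (u v : ℂ) (c : ZMod 5) :
    sideCross (u + v) c = sideCross u c + sideCross v c :=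
  cross_add_left u v _

theorem sideVec_ne_zero (c : ZMod 5) : sideVec c ≠ 0 := sideEnd_sub_sideStart_ne_zero c

theorem sideCross_sideVec_self (c : ZMod 5) : sideCross (sideVec c) c = 0 :=
  cross_self_eq_zero _

theorem sideCross_sideVec_succ (c : ZMod 5) :
    sideCross (sideVec c) (c + 1) = sideCross (sideVec 0) 1 := by
  have h := sideCross_rotate (sideVec 0) 1 c
  rwa [← sideVec_add, zero_add, add_comm 1 c] at h

theorem sideCross_sideVec_neg : sideCross (sideVec 0) 1 < 0 := by
  have h1 : sideVec 1 = corner 3 * sideVec 0 := by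
    have := sideVec_add 0 1
    rwa [zero_add, mul_one] at this
  have h2 : (corner 3).im < 0 := by
    have h3 : ((3 : ZMod 5).val : ℝ) = 3 := by norm_cast
    have e3 : 2 * Real.pi * 3 / 5 = Real.pi / 5 + Real.pi := by ring
    rw [corner_eq_exp, h3, e3, Complex.exp_ofReal_mul_I_im, Real.sin_add_pi, neg_lt_zero]
    apply Real.sin_pos_of_pos_of_lt_pi <;> linarith [Real.pi_pos]
  have h3 : sideCross (sideVec 0) 1 = Complex.normSq (sideVec 0) * (corner 3).im := by
    rw [sideCross, h1]; simp [cross, Complex.normSq_apply]; ring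
  rw [h3]
  exact mul_neg_of_pos_of_neg (Complex.normSq_pos.mpr (sideVec_ne_zero 0)) h2

theorem eq_of_sideCross_eq {u v : ℂ} {m : ZMod 5} (h0 : sideCross u m = sideCross v m)
    (h1 : sideCross u (m + 1) = sideCross v (m + 1)) : u = v := by
  have hδ : cross (sideVec m) (sideVec (m + 1)) ≠ 0 := by
    have := sideCross_sideVec_succ m
    rw [sideCross] at this
    rw [this]; exact sideCross_sideVec_neg.ne
  have e := fun w => cross_smul_eq (sideVec m) (sideVec (m + 1)) w
  have : cross (sideVec m) (sideVec (m + 1)) • u = cross (sideVec m) (sideVec (m + 1)) • v := by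
    rw [e, e]
    simp only [sideCross] at h0 h1
    rw [h0, h1]
  exact smul_right_injective ℂ hδ this

/-- The linear map that fixes the side `m` and reverses the side `m + 1`. -/
noncomputable def reflectMap (m : ZMod 5) : ℂ →ₗ[ℝ] ℂ where
  toFun u := (sideCross (sideVec 0) 1)⁻¹ •
    (sideCross u (m + 1) • sideVec m + sideCross u m • sideVec (m + 1))
  map_add' u v := by
    simp only [sideCross, cross_add_left, add_smul, smul_add]
    abel
  map_smul' r u := by
    simp only [sideCross, cross_smul_left, smul_add, smul_smul, RingHom.id_apply]
    congr 2 <;> ring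

theorem sideCross_reflectMap (m : ZMod 5) (u : ℂ) :
    sideCross (reflectMap m u) m = -sideCross u m := by
  have h := sideCross_sideVec_neg.ne
  have e0 : sideCross (sideVec (m + 1)) m = -sideCross (sideVec 0) 1 := by
    rw [sideCross, cross_swap]; exact congrArg Neg.neg (sideCross_sideVec_succ m)
  change sideCross ((sideCross (sideVec 0) 1)⁻¹ •
    (sideCross u (m + 1) • sideVec m + sideCross u m • sideVec (m + 1))) m = _
  rw [sideCross_smul, sideCross_add_left, sideCross_smul, sideCross_smul,
    sideCross_sideVec_self, e0]
  field_simp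
  ring

theorem sideCross_reflectMap_succ (m : ZMod 5) (u : ℂ) :
    sideCross (reflectMap m u) (m + 1) = sideCross u (m + 1) := by
  have h := sideCross_sideVec_neg.ne
  have e0 := sideCross_sideVec_succ m
  change sideCross ((sideCross (sideVec 0) 1)⁻¹ •
    (sideCross u (m + 1) • sideVec m + sideCross u m • sideVec (m + 1))) (m + 1) = _
  rw [sideCross_smul, sideCross_add_left, sideCross_smul, sideCross_smul,
    sideCross_sideVec_self, e0]
  field_simp
  ring

theorem reflectMap_involutive (m : ZMod 5) : Function.Involutive (reflectMap m) := by
  intro u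
  apply eq_of_sideCross_eq (m := m)
  · rw [sideCross_reflectMap, sideCross_reflectMap, neg_neg]
  · rw [sideCross_reflectMap_succ, sideCross_reflectMap_succ]

/-- The linear reflection that fixes the side `m` and reverses the side `m + 1`. -/
noncomputable def reflect (m : ZMod 5) : ℂ ≃ₗ[ℝ] ℂ :=
  LinearEquiv.ofInvolutive (reflectMap m) (reflectMap_involutive m)

theorem sideCross_reflect (m : ZMod 5) (u : ℂ) : sideCross (reflect m u) m = -sideCross u m :=
  sideCross_reflectMap m u

theorem sideCross_reflect_succ (m : ZMod 5) (u : ℂ) :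
    sideCross (reflect m u) (m + 1) = sideCross u (m + 1) :=
  sideCross_reflectMap_succ m u

theorem sideCross_neg (u : ℂ) (c : ZMod 5) : sideCross (-u) c = -sideCross u c := by
  rw [← neg_one_smul ℝ u, sideCross_smul, neg_one_mul]

theorem reflect_sideVec (m : ZMod 5) : reflect m (sideVec m) = sideVec m := by
  apply eq_of_sideCross_eq (m := m)
  · rw [sideCross_reflect, sideCross_sideVec_self, neg_zero]
  · rw [sideCross_reflect_succ]

theorem reflect_sideVec_succ (m : ZMod 5) : reflect m (sideVec (m + 1)) = -sideVec (m + 1) := by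
  apply eq_of_sideCross_eq (m := m)
  · rw [sideCross_reflect, sideCross_neg]
  · rw [sideCross_reflect_succ, sideCross_neg, sideCross_sideVec_self, neg_zero]

theorem reflect_rotate (m : ZMod 5) (u : ℂ) :
    corner (3 * m) * reflect 0 (corner (3 * -m) * u) = reflect m u := by
  have e0 : ∀ w : ℂ, sideCross (corner (3 * m) * w) m = sideCross w 0 := fun w => by
    have := sideCross_rotate w 0 m
    rwa [zero_add] at this
  have e1 : ∀ w : ℂ, sideCross (corner (3 * m) * w) (m + 1) = sideCross w (0 + 1) := fun w => by
    have := sideCross_rotate w 1 m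
    rwa [add_comm 1 m] at this
  apply eq_of_sideCross_eq (m := m)
  · rw [e0, sideCross_reflect, sideCross_reflect, ← e0, corner_mul_corner_neg]
  · rw [e1, sideCross_reflect_succ, sideCross_reflect_succ, ← e1, corner_mul_corner_neg]

/-- On the complement of a sector, the reflection acts on loops by substitution. -/
theorem HasLoops.reflect_zero {u : ℂ} {a A : List (ZMod 5)} (h : HasLoops u a A)
    (h0 : sideCross u 0 ≤ 0) (h1 : 0 ≤ sideCross u 1) :
    HasLoops (reflect 0 u) (substitute 0 a) (substitute 0 A) := by
  obtain ⟨x, hx⟩ : ∃ x, x = sideCross u 1 := ⟨_, rfl⟩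
  obtain ⟨y, hy⟩ : ∃ y, y = -sideCross u 0 := ⟨_, rfl⟩
  have hx0 : 0 ≤ x := hx ▸ h1
  have hy0 : 0 ≤ y := by linarith
  have hu : UStep u = HeightStep (sideHeight (-x) y) (midHeight (-x) y) :=
    uStep_eq (by rw [hx]) hy.symm
  have w0 : ∀ v, sideCross (-reflect 0 v) 0 = sideCross v 0 := fun v => by
    rw [sideCross_neg, sideCross_reflect, neg_neg]
  have w1 : ∀ v, sideCross (-reflect 0 v) 1 = -sideCross v 1 := fun v => by
    rw [sideCross_neg]
    exact congrArg Neg.neg (sideCross_reflect_succ 0 v)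
  have hw : UStep (-reflect 0 u) = HeightStep (sideHeight x y) (midHeight x y) :=
    uStep_eq (by rw [w1, hx, neg_neg]) (by rw [w0, hy])
  obtain ⟨ha, hA, hl, hv⟩ := h
  -- The zero vector has no steps, so a loop exists only in an actual direction.
  have hxy : 0 < x + y := by
    by_contra hc
    have hx' : x = 0 := by linarith
    have hy' : y = 0 := by linarith
    obtain ⟨hne, s, hs⟩ := ha
    rw [hu, hx', hy'] at hs
    rcases a with _ | ⟨c, a⟩
    · exact hne rfl
    obtain ⟨-, s', hs, -⟩ := hs
    have e : ∀ c, sideHeight (-0) 0 c = 0 := by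
      intro c
      rcases label_cases c with rfl | rfl | rfl | rfl | rfl <;>
        simp [sideHeight_zero, sideHeight_one, sideHeight_two, sideHeight_three, sideHeight_four]
    rcases hs with ⟨hs, -⟩ | ⟨hs, -⟩ <;> rw [e] at hs <;> exact lt_irrefl _ hs
  -- The opposite vector is the one whose two coordinates are both nonnegative.
  suffices HasLoops (-reflect 0 u) (substitute 0 a) (substitute 0 A) by
    have := this.smul (r := -1) (by norm_num)
    rwa [neg_one_smul, neg_neg] at this
  refine ⟨?_, ?_, fun l h => ?_, fun v => ?_⟩
  · rw [hw]; exact IsLoop.substitute hx0 hy0 (hu ▸ ha)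
  · rw [hw]; exact IsLoop.substitute hx0 hy0 (hu ▸ hA)
  · rw [hw] at h
    obtain ⟨l', hl', hr⟩ := h.exists_substitute hx0 hy0
    rw [← hu] at hl'
    obtain ⟨k, hk, h | h⟩ := hl l' hl'
    · refine ⟨k, hk, .inl ?_⟩
      rw [← substitute_wordPow]; exact hr.trans (substitute_isRotated 0 h)
    · refine ⟨k, hk, .inr ?_⟩
      rw [← substitute_wordPow]; exact hr.trans (substitute_isRotated 0 h)
  · rw [displacement_eq (u := -reflect 0 u) (x := x) (y := y) (a := -sideCross v 1)
      (b := -sideCross v 0) (by rw [w1, hx, neg_neg]) (by rw [w0, hy]) rfl rfl,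
      IsLoop.cycleSum_substitute hx0 hy0 hxy _ _ (hu ▸ hA),
      IsLoop.cycleSum_substitute hx0 hy0 hxy _ _ (hu ▸ ha),
      ← displacement_eq (u := u) (v := -reflect 0 v) (by rw [hx]) hy.symm
        (by rw [w1]) (by rw [w0]), hv]
    ring

theorem HasLoops.reflect {u : ℂ} {a A : List (ZMod 5)} (h : HasLoops u a A) {m : ZMod 5}
    (hm : sideCross u m * sideCross u (m + 1) ≤ 0) :
    HasLoops (reflect m u) (substitute m a) (substitute m A) := by
  have h' := h.rotate (-m)
  have e0 : sideCross (corner (3 * -m) * u) 0 = sideCross u m := by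
    have := sideCross_rotate u m (-m)
    rwa [add_neg_cancel] at this
  have e1 : sideCross (corner (3 * -m) * u) 1 = sideCross u (m + 1) := by
    have := sideCross_rotate u (m + 1) (-m)
    rwa [show m + 1 + -m = 1 by ring] at this
  have key : HasLoops (_root_.reflect 0 (corner (3 * -m) * u)) (substitute 0 (a.map (· + -m)))
      (substitute 0 (A.map (· + -m))) := by
    -- Rotation has moved the sector to `0`; of `u` and `-u`, one satisfies the sign conditions of
    -- `HasLoops.reflect_zero`.
    by_cases hc : sideCross u m ≤ 0 ∧ 0 ≤ sideCross u (m + 1)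
    · exact h'.reflect_zero (e0 ▸ hc.1) (e1 ▸ hc.2)
    · have hc' : 0 ≤ sideCross u m ∧ sideCross u (m + 1) ≤ 0 := by
        rcases mul_nonpos_iff.mp hm with h | h
        · exact h
        · exact absurd h hc
      have h2 := (h'.smul (r := -1) (by norm_num)).reflect_zero
        (by rw [sideCross_smul, e0]; linarith [hc'.1])
        (by rw [sideCross_smul, e1]; linarith [hc'.2])
      have h3 := h2.smul (r := -1) (by norm_num)
      rwa [neg_one_smul, neg_one_smul, map_neg, neg_neg] at h3
  have h4 := key.rotate m
  have e : ∀ l : List (ZMod 5), (substitute 0 (l.map (· + -m))).map (· + m) = substitute m l := by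
    intro l
    rw [← substitute_map_add, zero_add]
    congr 1
    simp [Function.comp_def]
  rwa [reflect_rotate, e, e] at h4

/-- In sector `0`, and up to a common sign, the heights of the sides `0, 1, 2, 3, 4` have signs `-,
-, +, -, +`: only the pair `0, 1` agrees. The general case follows by rotation. -/
theorem sideCross_sector {u : ℂ} {j m : ZMod 5} (hj : 0 ≤ sideCross u j * sideCross u (j + 1))
    (hm : m ≠ j) : sideCross u m * sideCross u (m + 1) ≤ 0 := by
  have key : ∀ w : ℂ, 0 ≤ sideCross w 0 * sideCross w 1 → ∀ c : ZMod 5, c ≠ 0 →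
      sideCross w c * sideCross w (c + 1) ≤ 0 := by
    intro w hw c hc
    have e := sideCross_eq w
    generalize sideCross w 0 = y at *
    generalize sideCross w 1 = x at *
    rw [e]
    have hφ := Real.goldenRatio_pos
    have h1 := mul_nonneg hφ.le hw
    have h2 := mul_nonneg hφ.le h1
    have h3 := mul_nonneg hφ.le (sq_nonneg x)
    have h4 := mul_nonneg hφ.le (sq_nonneg y)
    have h5 := mul_nonneg hφ.le h3
    have h6 := mul_nonneg hφ.le h4
    rcases label_cases c with rfl | rfl | rfl | rfl | rfl
    · exact absurd rfl hc
    all_goals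
      simp only [show (1 : ZMod 5) + 1 = 2 by decide, show (2 : ZMod 5) + 1 = 3 by decide,
        show (3 : ZMod 5) + 1 = 4 by decide, show (4 : ZMod 5) + 1 = 0 by decide,
        sideHeight_zero, sideHeight_one, sideHeight_two, sideHeight_three, sideHeight_four]
      nlinarith
  have e : ∀ c, sideCross (corner (3 * -j) * u) (c - j) = sideCross u c := by
    intro c
    rw [sub_eq_add_neg, sideCross_rotate]
  have h := key (corner (3 * -j) * u) ?_ (m - j) (sub_ne_zero.mpr hm)
  · rwa [show m - j + 1 = (m + 1) - j by ring, e, e] at h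
  · have e0 := e j
    have e1 := e (j + 1)
    rw [sub_self] at e0
    rw [add_sub_cancel_left] at e1
    rwa [e0, e1]

/-! ## The directions of the sides -/

/-- With `y = 0` the side `0` is never crossed, and a passage between `3` and `4` would need a
height shift equal to the sum of their half-widths. So the path breaks into the pairs `1, 4` and `3,
2`, the two strips. -/
theorem hasLoops_sideVec_zero : HasLoops (sideVec 0) [1, 4] [3, 2] := by
  obtain ⟨x, hx⟩ : ∃ x, x = -sideCross (sideVec 0) 1 := ⟨_, rfl⟩
  have hx0 : 0 < x := by linarith [sideCross_sideVec_neg]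
  have h0 : -sideCross (sideVec 0) 0 = 0 := by rw [sideCross_sideVec_self, neg_zero]
  have hu := uStep_eq hx.symm h0
  have hφ := goldenRatio_bounds
  have hφ2 := Real.goldenRatio_sq
  have pos : 0 < Real.goldenRatio * x := mul_pos Real.goldenRatio_pos hx0
  have steps : ∀ s t : ZMod 5 × ℝ, UStep (sideVec 0) s t →
      ((s.1 = 1 ∧ t.1 = 4 ∨ s.1 = 4 ∧ t.1 = 1) ∨ (s.1 = 3 ∧ t.1 = 2 ∨ s.1 = 2 ∧ t.1 = 3)) := by
    rintro ⟨c, η⟩ ⟨d, η'⟩ h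
    rw [hu] at h
    rcases label_cases c with rfl | rfl | rfl | rfl | rfl <;>
    rcases label_cases d with rfl | rfl | rfl | rfl | rfl <;>
    simp only [HeightStep, sideHeight_zero, sideHeight_one, sideHeight_two, sideHeight_three,
      sideHeight_four, midHeight_zero, midHeight_one, midHeight_two, midHeight_three,
      midHeight_four] at h ⊢ <;>
    first
    | (exfalso; rcases h with ⟨h1, h2, h3, h4, h5, h6, h7⟩ | ⟨h1, h2, h3, h4, h5, h6, h7⟩ <;>
        nlinarith)
    | simp
  have loop14 : IsLoop (UStep (sideVec 0)) [1, 4] := by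
    refine ⟨by simp, (1, 0), rfl, (4, 0), ?_, rfl, (1, 0), ?_, rfl⟩ <;> rw [hu]
    · left
      simp only [sideHeight_one, sideHeight_four, midHeight_one, midHeight_four]
      refine ⟨?_, ?_, ?_, ?_, ?_, ?_, ?_⟩ <;> nlinarith
    · right
      simp only [sideHeight_one, sideHeight_four, midHeight_one, midHeight_four]
      refine ⟨?_, ?_, ?_, ?_, ?_, ?_, ?_⟩ <;> nlinarith
  have loop32 : IsLoop (UStep (sideVec 0)) [3, 2] := by
    refine ⟨by simp, (3, 0), rfl, (2, 0), ?_, rfl, (3, 0), ?_, rfl⟩ <;> rw [hu]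
    · left
      simp only [sideHeight_three, sideHeight_two, midHeight_three, midHeight_two]
      refine ⟨?_, ?_, ?_, ?_, ?_, ?_, ?_⟩ <;> nlinarith
    · right
      simp only [sideHeight_three, sideHeight_two, midHeight_three, midHeight_two]
      refine ⟨?_, ?_, ?_, ?_, ?_, ?_, ?_⟩ <;> nlinarith
  refine ⟨loop14, loop32, fun l hl => ?_, fun v => ?_⟩
  · have alt : ∀ c d : ZMod 5, c ≠ d → (∀ s t, UStep (sideVec 0) s t → s.1 = c → t.1 = d) →
        (∀ s t, UStep (sideVec 0) s t → s.1 = d → t.1 = c) → ∀ (n : ℕ) (l : List (ZMod 5)) (s t),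
        l.length ≤ n → IsPath (UStep (sideVec 0)) s l t → s.1 = c → t.1 = c →
        ∃ k, l = wordPow [c, d] k := by
      intro c d hcd h1 h2 n
      induction n with
      | zero =>
        intro l s t hn _ _ _
        exact ⟨0, by rw [wordPow_zero]; exact List.length_eq_zero_iff.mp (by omega)⟩
      | succ n ih =>
        intro l s t hn hp hs ht
        rcases l with _ | ⟨e, _ | ⟨f, l⟩⟩
        · exact ⟨0, rfl⟩
        · obtain ⟨-, s', h3, h4⟩ := hp
          have h5 : s' = t := h4
          exact absurd (ht.symm.trans (h5 ▸ h1 _ _ h3 hs)) hcd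
        · obtain ⟨he, s', h3, hf, s'', h4, hp⟩ := hp
          have h5 := h1 _ _ h3 hs
          obtain ⟨k, rfl⟩ := ih l s'' t (by simp at hn; omega) hp (h2 _ _ h4 h5) ht
          refine ⟨k + 1, ?_⟩
          rw [wordPow_succ, ← he, ← hf, hs, h5]
          rfl
    have t14 : ∀ s t, UStep (sideVec 0) s t → s.1 = 1 → t.1 = 4 := fun s t h e => by
      have := steps s t h; rw [e] at this; revert this; generalize t.1 = d; revert d; decide
    have t41 : ∀ s t, UStep (sideVec 0) s t → s.1 = 4 → t.1 = 1 := fun s t h e => by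
      have := steps s t h; rw [e] at this; revert this; generalize t.1 = d; revert d; decide
    have t32 : ∀ s t, UStep (sideVec 0) s t → s.1 = 3 → t.1 = 2 := fun s t h e => by
      have := steps s t h; rw [e] at this; revert this; generalize t.1 = d; revert d; decide
    have t23 : ∀ s t, UStep (sideVec 0) s t → s.1 = 2 → t.1 = 3 := fun s t h e => by
      have := steps s t h; rw [e] at this; revert this; generalize t.1 = d; revert d; decide
    obtain ⟨hne, s, hs⟩ := hl
    have hk : ∀ w : List (ZMod 5), ∀ k, l = wordPow w k → 0 < k := by
      rintro w k rfl
      rcases k with _ | k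
      · exact absurd rfl hne
      · exact k.succ_pos
    have hfirst : s.1 = 1 ∨ s.1 = 4 ∨ s.1 = 3 ∨ s.1 = 2 := by
      rcases l with _ | ⟨c, l⟩
      · exact absurd rfl hne
      · obtain ⟨-, s', h1, -⟩ := hs
        have := steps s s' h1
        tauto
    rcases hfirst with h | h | h | h
    · obtain ⟨k, e⟩ := alt 1 4 (by decide) t14 t41 _ l s s le_rfl hs h h
      exact ⟨k, hk _ _ e, .inl (e ▸ List.IsRotated.refl _)⟩
    · obtain ⟨k, e⟩ := alt 4 1 (by decide) t41 t14 _ l s s le_rfl hs h h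
      exact ⟨k, hk _ _ e, .inl (e ▸ wordPow_isRotated (by decide) k)⟩
    · obtain ⟨k, e⟩ := alt 3 2 (by decide) t32 t23 _ l s s le_rfl hs h h
      exact ⟨k, hk _ _ e, .inr (e ▸ List.IsRotated.refl _)⟩
    · obtain ⟨k, e⟩ := alt 2 3 (by decide) t23 t32 _ l s s le_rfl hs h h
      exact ⟨k, hk _ _ e, .inr (e ▸ wordPow_isRotated (by decide) k)⟩
  · rw [displacement_eq hx.symm h0 rfl rfl]
    have p2 : 0 < sideHeight x 0 2 := by rw [sideHeight_two]; linarith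
    have p4 : 0 < sideHeight x 0 4 := by rw [sideHeight_four]; linarith
    have p1 : ¬ 0 < sideHeight x 0 1 := by rw [sideHeight_one]; linarith
    have p3 : ¬ 0 < sideHeight x 0 3 := by rw [sideHeight_three]; nlinarith
    simp only [cycleSum, edgeSum, List.headD_cons, List.headD_nil, displacement, p1, p2, p3, p4,
      if_true, if_false, midHeight_one, midHeight_two, midHeight_three, midHeight_four]
    linear_combination (2 * (-sideCross v 0)) * hφ2

theorem hasLoops_sideVec (c : ZMod 5) : HasLoops (sideVec c) [1 + c, 4 + c] [3 + c, 2 + c] := by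
  have h := hasLoops_sideVec_zero.rotate c
  rwa [← sideVec_add, zero_add] at h

theorem hasLoops_reflect_sideVec {c m : ZMod 5} (h : m ≠ c) :
    HasLoops (reflect m (sideVec c)) (substitute m [1 + c, 4 + c]) (substitute m [3 + c, 2 + c]) :=
  (hasLoops_sideVec c).reflect <|
    sideCross_sector (j := c) (by rw [sideCross_sideVec_self, zero_mul]) h

/-! ## Crossings and their heights -/

theorem units_smul_complex (ε : ℤˣ) (z : ℂ) : ε • z = ((ε : ℤ) : ℝ) • z := by
  rcases Int.units_eq_one_or ε with rfl | rfl <;> simp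

theorem units_real_sq (ε : ℤˣ) : (((ε : ℤ) : ℝ)) * ((ε : ℤ) : ℝ) = 1 := by
  rcases Int.units_eq_one_or ε with rfl | rfl <;> simp

/-- The outward normal is the side vector turned by a right angle and scaled by `cot (π / 5)`, which
is the constant `t`. Exiting is thus a sign condition on the height, and direction and label
determine the pentagon. -/
theorem exists_inner_sideNormal :
    ∃ t : ℝ, 0 < t ∧ ∀ (c : ZMod 5) (u : ℂ), inner ℝ (sideNormal c) u = t * sideCross u c := by
  have hv : ((1 : ZMod 5).val : ℝ) = 1 := by norm_cast
  have hs : 0 < Real.sin (2 * Real.pi * 1 / 5) := by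
    apply Real.sin_pos_of_pos_of_lt_pi <;> linarith [Real.pi_pos]
  have hre : (corner 1).re = Real.cos (2 * Real.pi * 1 / 5) := by
    rw [corner_eq_exp, hv, Complex.exp_ofReal_mul_I_re]
  have him : (corner 1).im = Real.sin (2 * Real.pi * 1 / 5) := by
    rw [corner_eq_exp, hv, Complex.exp_ofReal_mul_I_im]
  have hcs := Real.sin_sq_add_cos_sq (2 * Real.pi * 1 / 5)
  generalize Real.cos (2 * Real.pi * 1 / 5) = x at *
  generalize Real.sin (2 * Real.pi * 1 / 5) = y at *
  have hx : 0 < 1 - x := by nlinarith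
  refine ⟨y / (1 - x), by positivity, fun c u => ?_⟩
  have e1 : sideNormal c = corner (3 * c) * (1 + corner 1) := by
    rw [sideNormal, sideStart, sideEnd, corner_add]; ring
  have e2 : sideVec c = corner (3 * c) * (corner 1 - 1) := by
    rw [sideVec, sideStart, sideEnd, corner_add]; ring
  have e3 : y / (1 - x) * y = 1 + x := by field_simp; nlinarith
  have e4 : y / (1 - x) * (1 - x) = y := by field_simp
  generalize y / (1 - x) = t at *
  rw [sideCross, e1, e2, Complex.inner]
  generalize corner (3 * c) = z
  simp only [cross, map_mul, map_add, map_one, Complex.mul_re, Complex.mul_im, Complex.add_re,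
    Complex.add_im, Complex.sub_re, Complex.sub_im, Complex.conj_re, Complex.conj_im,
    Complex.one_re, Complex.one_im, hre, him]
  linear_combination (-(u.re * z.re + u.im * z.im)) * e3 + (u.re * z.im - u.im * z.re) * e4

theorem Crossing.isExit_iff {u : ℂ} {s : Crossing} :
    s.IsExit u ↔ 0 < ((s.sheet : ℤ) : ℝ) * sideCross u s.side ∧ ∃ μ : ℝ, |μ| < 1 ∧
      s.point = (((s.sheet : ℤ) : ℝ) / 2) • (sideNormal s.side + μ • sideVec s.side) := by
  obtain ⟨t, ht, hin⟩ := exists_inner_sideNormal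
  rw [Crossing.IsExit, and_comm]
  apply and_congr
  · rw [units_smul_complex, real_inner_smul_left, hin, mul_left_comm, mul_pos_iff_of_pos_left ht]
  · rw [units_smul_complex, units_smul_complex, openSegment, Set.mem_ofPred_eq]
    generalize ((s.sheet : ℤ) : ℝ) = e
    constructor
    · rintro ⟨a, b, ha, hb, hab, h⟩
      refine ⟨b - a, abs_lt.mpr ⟨by linarith, by linarith⟩, ?_⟩
      rw [← h, sideNormal, sideVec]
      obtain rfl : a = 1 - b := by linarith
      module
    · rintro ⟨μ, hμ, h⟩
      rw [abs_lt] at hμ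
      refine ⟨(1 - μ) / 2, (1 + μ) / 2, by linarith, by linarith, by ring, ?_⟩
      rw [h, sideNormal, sideVec]
      module

/-- The label of the crossed side, with the height of the crossing point above the midpoint of the
side, doubled. -/
noncomputable def Crossing.state (u : ℂ) (s : Crossing) : ZMod 5 × ℝ :=
  (s.side, 2 * cross u s.point - ((s.sheet : ℤ) : ℝ) * normalCross u s.side)

/-- The crossing with a given label and height. -/
noncomputable def crossingOf (u : ℂ) (z : ZMod 5 × ℝ) : Crossing where
  sheet := if 0 < sideCross u z.1 then 1 else -1
  side := z.1
  point := ((((if 0 < sideCross u z.1 then 1 else -1 : ℤˣ) : ℤ) : ℝ) / 2) •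
    (sideNormal z.1 + (z.2 / |sideCross u z.1|) • sideVec z.1)

theorem Crossing.IsExit.abs_state_lt {u : ℂ} {s : Crossing} (h : s.IsExit u) :
    |(s.state u).2| < |sideCross u s.side| := by
  rw [Crossing.isExit_iff] at h
  obtain ⟨h1, μ, hμ, h2⟩ := h
  have e := units_real_sq s.sheet
  rw [Crossing.state, h2, cross_smul_right, cross_add_right, cross_smul_right]
  change |2 * (_ / 2 * (normalCross u s.side + μ * sideCross u s.side)) - _| < _
  have h3 : |sideCross u s.side| = ((s.sheet : ℤ) : ℝ) * sideCross u s.side := by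
    rcases Int.units_eq_one_or s.sheet with h | h <;> rw [h] at h1 ⊢ <;> simp at h1 ⊢
    · exact h1.le
    · exact h1.le
  rw [h3, show 2 * (((s.sheet : ℤ) : ℝ) / 2 * (normalCross u s.side + μ * sideCross u s.side)) -
    ((s.sheet : ℤ) : ℝ) * normalCross u s.side = μ * (((s.sheet : ℤ) : ℝ) * sideCross u s.side) by
    ring, abs_mul, abs_of_pos h1]
  nlinarith

theorem Crossing.IsExit.crossingOf_state {u : ℂ} {s : Crossing} (h : s.IsExit u) :
    crossingOf u (s.state u) = s := by
  rw [Crossing.isExit_iff] at h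
  obtain ⟨h1, μ, hμ, h2⟩ := h
  obtain ⟨ε, c, x⟩ := s
  simp only at h1 h2
  have hε : (if 0 < sideCross u c then 1 else -1 : ℤˣ) = ε := by
    rcases Int.units_eq_one_or ε with h | h <;> rw [h] at h1 ⊢ <;> simp at h1 ⊢
    · exact h1
    · exact h1.le
  have h3 : |sideCross u c| = ((ε : ℤ) : ℝ) * sideCross u c := by
    rcases Int.units_eq_one_or ε with h | h <;> rw [h] at h1 ⊢ <;> simp at h1 ⊢
    · exact h1.le
    · exact h1.le
  have h4 : (2 * cross u x - ((ε : ℤ) : ℝ) * normalCross u c) / |sideCross u c| = μ := by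
    rw [h2, cross_smul_right, cross_add_right, cross_smul_right, h3, div_eq_iff h1.ne']
    change 2 * (_ / 2 * (normalCross u c + μ * sideCross u c)) - _ = _
    ring
  rw [crossingOf, Crossing.state]
  simp only [hε, h4]
  rw [h2]

theorem isExit_crossingOf {u : ℂ} {z : ZMod 5 × ℝ} (h : |z.2| < |sideCross u z.1|) :
    (crossingOf u z).IsExit u := by
  have h0 : 0 < |sideCross u z.1| := (abs_nonneg _).trans_lt h
  rw [Crossing.isExit_iff]
  refine ⟨?_, z.2 / |sideCross u z.1|, ?_, rfl⟩
  · simp only [crossingOf]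
    split_ifs with h
    · simpa using h
    · have := lt_of_le_of_ne (not_lt.mp h) (abs_pos.mp h0)
      simpa using this
  · rw [abs_div, abs_abs, div_lt_one h0]
    exact h

theorem state_crossingOf {u : ℂ} {z : ZMod 5 × ℝ} (h : sideCross u z.1 ≠ 0) :
    (crossingOf u z).state u = z := by
  have h0 : 0 < |sideCross u z.1| := abs_pos.mpr h
  rw [Crossing.state, crossingOf]
  ext
  · rfl
  · simp only [cross_smul_right, cross_add_right]
    change 2 * (_ / 2 * (normalCross u z.1 + _ / _ * sideCross u z.1)) - _ = _
    rcases lt_or_gt_of_ne h with h | h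
    · rw [if_neg h.not_gt, abs_of_neg h, Units.val_neg, Units.val_one]
      push_cast
      field_simp
      ring
    · rw [if_pos h, abs_of_pos h, Units.val_one]
      push_cast
      field_simp
      ring

theorem Crossing.Step.uStep {u : ℂ} {s t : Crossing} (h : s.Step u t) :
    UStep u (s.state u) (t.state u) := by
  obtain ⟨hs, ht, hst, τ, -, hτ⟩ := h
  have as := abs_lt.mp hs.abs_state_lt
  have at' := abs_lt.mp ht.abs_state_lt
  have hs1 := (Crossing.isExit_iff.mp hs).1
  have ht1 := (Crossing.isExit_iff.mp ht).1
  have e : (t.state u).2 = (s.state u).2 +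
      ((s.sheet : ℤ) : ℝ) * (normalCross u t.side - normalCross u s.side) := by
    simp only [Crossing.state]
    rw [hτ, Crossing.entry, cross_add_right, cross_smul_right, cross_self_eq_zero, cross_sub_right,
      units_smul_complex, cross_smul_right, hst, Units.val_neg]
    push_cast
    change _ = 2 * cross u s.point - ((s.sheet : ℤ) : ℝ) * normalCross u s.side + _
    rw [show cross u (sideNormal s.side) = normalCross u s.side from rfl]
    ring
  rw [hst] at ht1
  rcases Int.units_eq_one_or s.sheet with h | h
  · rw [h] at hs1 ht1 e
    simp at hs1 ht1 e
    rw [abs_of_pos hs1] at as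
    rw [abs_of_neg ht1, neg_neg] at at'
    exact .inr ⟨hs1, ht1, as.1, as.2, at'.1, at'.2, e⟩
  · rw [h] at hs1 ht1 e
    simp at hs1 ht1 e
    rw [abs_of_neg hs1, neg_neg] at as
    rw [abs_of_pos ht1] at at'
    refine .inl ⟨hs1, ht1, as.1, as.2, at'.1, at'.2, ?_⟩
    change _ = _ - (normalCross u t.side - normalCross u s.side)
    rw [e]; ring

/-- Strict convexity: an interior point of another side lies strictly on the inner side of the line
through the side `d`. -/
theorem normalCross_sideVec_lt {c d : ZMod 5} (h : c ≠ d) {μ : ℝ} (hμ : |μ| < 1) :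
    normalCross (sideVec d) d < normalCross (sideVec d) c + μ * sideCross (sideVec d) c := by
  have key : ∀ c : ZMod 5, c ≠ 0 →
      normalCross (sideVec 0) 0 < normalCross (sideVec 0) c + μ * sideCross (sideVec 0) c := by
    intro c hc
    have h1 := normalCross_sub (sideVec 0) c
    have h2 := congrFun (sideCross_eq (sideVec 0)) c
    rw [sideCross_sideVec_self, neg_zero] at h1 h2
    have hx := sideCross_sideVec_neg
    have hφ := Real.goldenRatio_pos
    generalize sideCross (sideVec 0) 1 = x at *
    rw [abs_lt] at hμ
    rw [h2]
    have hp : Real.goldenRatio * x < 0 := mul_neg_of_pos_of_neg hφ hx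
    rcases label_cases c with rfl | rfl | rfl | rfl | rfl
    · exact absurd rfl hc
    all_goals
      simp only [sideHeight_one, sideHeight_two, sideHeight_three, sideHeight_four, midHeight_one,
        midHeight_two, midHeight_three, midHeight_four] at *
      nlinarith
  have h1 := key (c - d) (sub_ne_zero.mpr h)
  have e1 := normalCross_rotate (sideVec 0) (c - d) d
  have e2 := normalCross_rotate (sideVec 0) 0 d
  have e3 := sideCross_rotate (sideVec 0) (c - d) d
  rw [← sideVec_add, zero_add, sub_add_cancel] at e1 e3
  rw [← sideVec_add, zero_add] at e2
  rwa [e1, e2, e3]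

theorem eq_smul_of_cross_eq_zero {u v : ℂ} (hu : u ≠ 0) (h : cross u v = 0) :
    ∃ τ : ℝ, v = τ • u := by
  have hn : Complex.normSq u ≠ 0 := (Complex.normSq_pos.mpr hu).ne'
  have hn' : u.re * u.re + u.im * u.im ≠ 0 := by rwa [← Complex.normSq_apply]
  refine ⟨(u.re * v.re + u.im * v.im) / Complex.normSq u, ?_⟩
  rw [cross] at h
  rw [Complex.normSq_apply]
  apply Complex.ext <;> simp only [Complex.smul_re, Complex.smul_im, smul_eq_mul] <;>
    rw [div_mul_eq_mul_div, eq_div_iff hn']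
  · linear_combination (-u.im) * h
  · linear_combination u.re * h

theorem UStep.ne_zero {u : ℂ} {s t : ZMod 5 × ℝ} (h : UStep u s t) : u ≠ 0 := by
  rintro rfl
  have e : ∀ c, sideCross 0 c = 0 := fun c => by simp [sideCross, cross]
  rcases h with ⟨h, -⟩ | ⟨h, -⟩ <;> rw [e] at h <;> exact lt_irrefl _ h

theorem UStep.bounds {u : ℂ} {s t : ZMod 5 × ℝ} (h : UStep u s t) :
    |s.2| < |sideCross u s.1| ∧ |t.2| < |sideCross u t.1| := by
  rcases h with ⟨h1, h2, h3, h4, h5, h6, -⟩ | ⟨h1, h2, h3, h4, h5, h6, -⟩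
  · rw [abs_of_neg h1, abs_of_pos h2, abs_lt, abs_lt, neg_neg]
    exact ⟨⟨h3, h4⟩, h5, h6⟩
  · rw [abs_of_pos h1, abs_of_neg h2, abs_lt, abs_lt, neg_neg]
    exact ⟨⟨h3, h4⟩, h5, h6⟩

theorem UStep.sheet {u : ℂ} {s t : ZMod 5 × ℝ} (h : UStep u s t) :
    (crossingOf u t).sheet = -(crossingOf u s).sheet := by
  rcases h with ⟨h1, h2, -⟩ | ⟨h1, h2, -⟩
  · simp only [crossingOf, if_neg h1.not_gt, if_pos h2, neg_neg]
  · simp only [crossingOf, if_neg h2.not_gt, if_pos h1]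

theorem UStep.step {u : ℂ} {s t : ZMod 5 × ℝ} (h : UStep u s t) :
    (crossingOf u s).Step u (crossingOf u t) := by
  have hu := h.ne_zero
  obtain ⟨b1, b2⟩ := h.bounds
  have x1 := isExit_crossingOf b1
  have x2 := isExit_crossingOf b2
  have hsheet := h.sheet
  have hs0 : sideCross u s.1 ≠ 0 := abs_pos.mp ((abs_nonneg _).trans_lt b1)
  have ht0 : sideCross u t.1 ≠ 0 := abs_pos.mp ((abs_nonneg _).trans_lt b2)
  have y1 := congrArg Prod.snd (state_crossingOf hs0)
  have y2 := congrArg Prod.snd (state_crossingOf ht0)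
  have hne : s.1 ≠ t.1 := by
    intro e
    rcases h with ⟨h1, h2, -⟩ | ⟨h1, h2, -⟩ <;> rw [e] at h1 <;> linarith
  refine ⟨x1, x2, hsheet, ?_⟩
  obtain ⟨p1, μ, hμ, q1⟩ := Crossing.isExit_iff.mp x1
  obtain ⟨p2, ν, hν, q2⟩ := Crossing.isExit_iff.mp x2
  have hc : cross u ((crossingOf u t).point - (crossingOf u s).entry) = 0 := by
    rw [Crossing.entry, cross_sub_right, cross_sub_right, units_smul_complex, cross_smul_right]
    simp only [Crossing.state] at y1 y2
    have e1 : (crossingOf u s).side = s.1 := rfl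
    have e2 : (crossingOf u t).side = t.1 := rfl
    rw [e1] at y1 p1 ⊢
    rw [e2] at y2 p2
    rw [show cross u (sideNormal s.1) = normalCross u s.1 from rfl]
    rw [hsheet, Units.val_neg] at y2 p2
    rcases Int.units_eq_one_or (crossingOf u s).sheet with k | k <;> rw [k] at y1 y2 p1 p2 ⊢ <;>
      simp at y1 y2 p1 p2 ⊢ <;>
      rcases h with ⟨h1, h2, -, -, -, -, h3⟩ | ⟨h1, h2, -, -, -, -, h3⟩ <;> linarith
  obtain ⟨τ, hτ⟩ := eq_smul_of_cross_eq_zero hu hc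
  refine ⟨τ, ?_, by rw [← hτ]; ring⟩
  -- The entry point is the point with parameter `-μ` of the side `s` of the pentagon that is
  -- entered. It lies strictly inside the line through the exit side, which forces `τ` to be
  -- positive.
  have hlt := normalCross_sideVec_lt hne (μ := -μ) (by rwa [abs_neg])
  have e : cross (sideVec t.1) (τ • u) = -(τ * sideCross u t.1) := by
    rw [cross_smul_right, cross_swap, sideCross]; ring
  rw [← hτ, Crossing.entry, q1, q2, units_smul_complex, hsheet] at e
  simp only [cross_sub_right, cross_smul_right, cross_add_right] at e
  change _ / 2 * (normalCross (sideVec t.1) t.1 + ν * sideCross (sideVec t.1) t.1) -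
    (_ / 2 * (normalCross (sideVec t.1) s.1 + μ * sideCross (sideVec t.1) s.1) -
      _ * normalCross (sideVec t.1) s.1) = _ at e
  rw [sideCross_sideVec_self] at e
  rw [hsheet] at p2
  change 0 < _ * sideCross u t.1 at p2
  rcases Int.units_eq_one_or (crossingOf u s).sheet with k | k <;> rw [k] at e p2 <;>
    simp at e p2 <;> by_contra hcon <;> nlinarith

/-! ## Closed trajectories as loops -/

/-- The Euclidean length of the loop `l` of direction `u`, scaled by `2 * ‖u‖`. -/
noncomputable def scaledLength (u : ℂ) (l : List (ZMod 5)) : ℝ :=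
  cycleSum (displacement (sideCross u) (normalCross (-Complex.I * u))) l

theorem cross_I_mul (u z : ℂ) : cross (-Complex.I * u) (z) = u.re * z.re + u.im * z.im := by
  simp [cross]; ring

/-- The position of a crossing in the direction `u`, relative to the midpoint of the side. -/
noncomputable def Crossing.advance (u : ℂ) (s : Crossing) : ℝ :=
  2 * cross (-Complex.I * u) s.point - ((s.sheet : ℤ) : ℝ) * normalCross (-Complex.I * u) s.side

/-- The cross product with `-i u` is the inner product with `u`, so it measures length along the
trajectory. The `advance` terms, the positions relative to the midpoints, cancel over a period. -/
theorem Crossing.Step.displacement_eq {u : ℂ} {s t : Crossing} (h : s.Step u t) :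
    2 * ‖u‖ * ‖t.point - s.entry‖ = t.advance u - s.advance u +
      displacement (sideCross u) (normalCross (-Complex.I * u)) s.side t.side := by
  obtain ⟨hs, ht, hst, τ, h0, hτ⟩ := h
  have ht1 := (Crossing.isExit_iff.mp ht).1
  have e1 : ‖t.point - s.entry‖ = τ * ‖u‖ := by
    rw [hτ, add_sub_cancel_left, norm_smul, Real.norm_of_nonneg h0.le]
  have e2 : cross (-Complex.I * u) (t.point - s.entry) = τ * (‖u‖ * ‖u‖) := by
    rw [hτ, add_sub_cancel_left, cross_smul_right, cross_I_mul, ← Complex.normSq_apply,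
      Complex.normSq_eq_norm_sq, sq]
  rw [e1, show 2 * ‖u‖ * (τ * ‖u‖) = 2 * (τ * (‖u‖ * ‖u‖)) by ring, ← e2, Crossing.entry,
    units_smul_complex, cross_sub_right, cross_sub_right, cross_smul_right, Crossing.advance,
    Crossing.advance, displacement]
  rw [show cross (-Complex.I * u) (sideNormal s.side) = normalCross (-Complex.I * u) s.side
    from rfl]
  rw [hst, Units.val_neg] at ht1 ⊢
  rcases Int.units_eq_one_or s.sheet with h | h <;> rw [h] at ht1 ⊢ <;> simp at ht1 ⊢
  · rw [if_neg ht1.not_gt]; ring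
  · rw [if_pos ht1]; ring

theorem isPath_of_forall {R : ZMod 5 × ℝ → ZMod 5 × ℝ → Prop} {f : ℕ → ZMod 5 × ℝ} (m n : ℕ)
    (h : ∀ i, m ≤ i → i < m + n → R (f i) (f (i + 1))) :
    IsPath R (f m) ((List.range n).map fun i => (f (m + i)).1) (f (m + n)) := by
  induction n with
  | zero => exact rfl
  | succ n ih =>
    rw [List.range_succ, List.map_append, isPath_append]
    exact ⟨_, ih fun i h1 h2 => h i h1 (by omega), rfl, _, h _ (by omega) (by omega), rfl⟩

theorem IsPath.exists_states {R : ZMod 5 × ℝ → ZMod 5 × ℝ → Prop} {s t : ZMod 5 × ℝ}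
    {l : List (ZMod 5)} (h : IsPath R s l t) :
    ∃ f : ℕ → ZMod 5 × ℝ, f 0 = s ∧ f l.length = t ∧
      (∀ i < l.length, R (f i) (f (i + 1))) ∧ l = (List.range l.length).map fun i => (f i).1 := by
  induction l generalizing s with
  | nil => exact ⟨fun _ => s, rfl, h, by simp, rfl⟩
  | cons c l ih =>
    obtain ⟨hc, s', h1, h2⟩ := h
    obtain ⟨f, f0, f1, f2, f3⟩ := ih h2
    refine ⟨fun i => i.casesOn s f, rfl, f1, ?_, ?_⟩
    · rintro (_ | i) hi
      · simpa [f0] using h1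
      · exact f2 i (by simpa using hi)
    · rw [List.length_cons, List.range_succ_eq_map, List.map_cons, List.map_map]
      congr 1
      · exact hc.symm

theorem edgeSum_map_range (f : ZMod 5 → ZMod 5 → ℝ) (g : ℕ → ZMod 5) (n : ℕ) :
    edgeSum f ((List.range n).map g) (g n) = ∑ i ∈ Finset.range n, f (g i) (g (i + 1)) := by
  induction n with
  | zero => rfl
  | succ n ih =>
    rw [List.range_succ, List.map_append, edgeSum_append, Finset.sum_range_succ, ← ih]
    simp [edgeSum]

theorem headD_map_range (g : ℕ → ZMod 5) {n : ℕ} (hn : 0 < n) (t : ZMod 5) :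
    ((List.range n).map g).headD t = g 0 := by
  obtain ⟨n, rfl⟩ := Nat.exists_eq_succ_of_ne_zero hn.ne'
  rw [List.range_succ_eq_map]
  rfl

theorem scaledLength_eq {u : ℂ} {n : ℕ} {γ : ℕ → Crossing} (hn : 0 < n)
    (hp : γ n = γ 0) (h : ∀ i, (γ i).Step u (γ (i + 1))) :
    scaledLength u ((List.range n).map fun i => (γ i).side) =
      2 * ‖u‖ * trajectoryLength n γ := by
  rw [scaledLength, cycleSum_eq _ _ 0, headD_map_range _ hn,
    show (γ 0).side = (fun i => (γ i).side) n by rw [← hp],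
    edgeSum_map_range, trajectoryLength, Finset.mul_sum,
    Finset.sum_congr rfl fun i _ => (h i).displacement_eq, Finset.sum_add_distrib,
    Finset.sum_range_sub (fun i => (γ i).advance u), hp, sub_self, zero_add]

theorem IsLoop.exists_crossings {u : ℂ} {l : List (ZMod 5)} (h : IsLoop (UStep u) l) :
    ∃ f : ℕ → ZMod 5 × ℝ, Function.Periodic f l.length ∧ (∀ i, UStep u (f i) (f (i + 1))) ∧
      l = (List.range l.length).map fun i => (f i).1 := by
  obtain ⟨hl, s, hs⟩ := h
  obtain ⟨f, f0, f1, f2, f3⟩ := hs.exists_states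
  have hn : 0 < l.length := List.length_pos_iff.mpr hl
  refine ⟨fun i => f (i % l.length), fun i => by simp, fun i => ?_, ?_⟩
  · have h1 := f2 (i % l.length) (Nat.mod_lt _ hn)
    have h2 : f ((i + 1) % l.length) = f (i % l.length + 1) := by
      rcases Nat.lt_or_ge (i % l.length + 1) l.length with h | h
      · rw [← Nat.mod_eq_of_lt h, Nat.mod_add_mod]
      · have h3 : i % l.length + 1 = l.length := le_antisymm (Nat.mod_lt _ hn) h
        rw [h3, f1, ← f0, ← Nat.mod_add_mod, h3, Nat.mod_self]
    rwa [← h2] at h1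
  · refine f3.trans (List.map_congr_left fun i hi => ?_)
    change (f i).1 = (f (i % l.length)).1
    rw [Nat.mod_eq_of_lt (List.mem_range.mp hi)]

theorem IsLoop.scaledLength_pos {u : ℂ} {l : List (ZMod 5)} (h : IsLoop (UStep u) l) :
    0 < scaledLength u l := by
  obtain ⟨f, h1, h2, h3⟩ := h.exists_crossings
  have hn : 0 < l.length := List.length_pos_iff.mpr h.1
  have e := scaledLength_eq (γ := fun i => crossingOf u (f i)) hn
    (by have := h1 0; rw [zero_add] at this; simp only [this]) fun i => (h2 i).step
  have e2 : ((List.range l.length).map fun i => (crossingOf u (f i)).side) = l := h3.symm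
  rw [e2] at e
  have hu := norm_pos_iff.mpr (h2 0).ne_zero
  rw [e]
  refine mul_pos (by positivity) (Finset.sum_pos (fun i _ => ?_) ⟨0, Finset.mem_range.mpr hn⟩)
  obtain ⟨-, -, -, τ, hτ, e⟩ := (h2 i).step
  simp only at e ⊢
  rw [e, add_sub_cancel_left, norm_smul]
  exact mul_pos (by simpa using hτ.ne') hu

/-- A path that returns to its first label therefore closes up exactly when its displacement
measured against `u` itself vanishes. -/
theorem UStep.snd_eq {u : ℂ} {s t : ZMod 5 × ℝ} (h : UStep u s t) :
    t.2 = s.2 - displacement (sideCross u) (normalCross u) s.1 t.1 := by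
  rw [displacement]
  rcases h with ⟨-, h1, -, -, -, -, h2⟩ | ⟨-, h1, -, -, -, -, h2⟩
  · rw [if_pos h1, h2]
  · rw [if_neg h1.not_gt, h2]; ring

theorem IsPath.snd_eq {u : ℂ} {s t : ZMod 5 × ℝ} {l : List (ZMod 5)} (h : IsPath (UStep u) s l t) :
    t.2 = s.2 - edgeSum (displacement (sideCross u) (normalCross u)) l t.1 := by
  induction l generalizing s with
  | nil => rw [show s = t from h, edgeSum, sub_zero]
  | cons c l ih =>
    obtain ⟨rfl, s', h1, h2⟩ := h
    rw [ih h2, edgeSum, h2.headD_eq, h1.snd_eq]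
    ring

theorem scaledLength_smul {u : ℂ} {r : ℝ} {l : List (ZMod 5)} (hl : IsLoop (UStep (r • u)) l) :
    scaledLength (r • u) l = |r| * scaledLength u l := by
  refine hl.cycleSum_eq fun s t h => ?_
  have e : ∀ c, normalCross (-Complex.I * r • u) c = r * normalCross (-Complex.I * u) c :=
    fun c => by rw [mul_smul_comm, normalCross_smul]
  rw [displacement, displacement, sideCross_smul, e, e]
  have h0 : r * sideCross u t.1 ≠ 0 := by
    rw [← sideCross_smul]
    exact abs_pos.mp ((abs_nonneg _).trans_lt h.bounds.2)
  rcases lt_or_gt_of_ne (left_ne_zero_of_mul h0) with hr | hr <;>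
  rcases lt_or_gt_of_ne (right_ne_zero_of_mul h0) with hx | hx
  · rw [if_pos (mul_pos_of_neg_of_neg hr hx), if_neg hx.not_gt, abs_of_neg hr]; ring
  · rw [if_neg (mul_neg_of_neg_of_pos hr hx).not_gt, if_pos hx, abs_of_neg hr]; ring
  · rw [if_neg (mul_neg_of_pos_of_neg hr hx).not_gt, if_neg hx.not_gt, abs_of_pos hr]; ring
  · rw [if_pos (mul_pos hr hx), if_pos hx, abs_of_pos hr]; ring

/-- The word of a closed trajectory is not a proper power. -/
theorem wordPow_eq_one_of_periodic {u : ℂ} {n : ℕ} {γ : ℕ → Crossing} (hn : 0 < n)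
    (hp : γ n = γ 0) (hmin : ∀ i, 0 < i → i < n → γ i ≠ γ 0)
    (h : ∀ i, (γ i).Step u (γ (i + 1))) {w : List (ZMod 5)} {k : ℕ}
    (hw : ((List.range n).map fun i => (γ i).side) ~r wordPow w k) : k ≤ 1 := by
  obtain ⟨w', -, e⟩ := exists_eq_wordPow_of_isRotated hw
  by_contra! hk
  obtain ⟨k, rfl⟩ := Nat.exists_eq_add_of_le' hk
  have hlen := congrArg List.length e
  rw [List.length_map, List.length_range, length_wordPow] at hlen
  have hm : 0 < w'.length := by
    rcases Nat.eq_zero_or_pos w'.length with h | h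
    · rw [h, mul_zero] at hlen; omega
    · exact h
  have hmn : w'.length < n := by rw [hlen]; nlinarith
  have path : ∀ m, IsPath (UStep u) ((γ 0).state u) ((List.range m).map fun i => (γ i).side)
      ((γ m).state u) := fun m => by
    have := isPath_of_forall (R := UStep u) (f := fun i => (γ i).state u) 0 m
      fun i _ _ => (h i).uStep
    simp only [zero_add] at this
    exact this
  have htake : ((List.range w'.length).map fun i => (γ i).side) = w' := by
    have e1 := congrArg (List.take w'.length) e
    rwa [← List.map_take, List.take_range, Nat.min_eq_left hmn.le, wordPow_succ,
      List.take_left] at e1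
  have hside : (γ w'.length).side = (γ 0).side := by
    have e1 : ∀ i < n, ((List.range n).map fun i => (γ i).side)[i]? = some (γ i).side := by
      intro i hi
      simp [hi]
    have e2 := e1 _ hmn
    have e3 := e1 0 hn
    rw [e, wordPow_succ] at e2 e3
    rw [List.getElem?_append_right le_rfl, Nat.sub_self, wordPow_succ,
      List.getElem?_append_left hm] at e2
    rw [List.getElem?_append_left hm] at e3
    exact Option.some.inj (e2.symm.trans e3)
  have s1 := (path n).snd_eq
  have s2 := (path w'.length).snd_eq
  rw [hp] at s1
  have c1 : edgeSum (displacement (sideCross u) (normalCross u))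
      ((List.range n).map fun i => (γ i).side) (γ 0).side = 0 := by
    change _ = _ - edgeSum _ _ (γ 0).side at s1
    linarith
  have c2 : cycleSum (displacement (sideCross u) (normalCross u)) (wordPow w' (k + 2)) = 0 := by
    rw [← e, cycleSum_eq _ _ 0, headD_map_range _ hn, c1]
  -- The height changes by the same amount over each of the `k + 2` copies of `w'`, and by zero in
  -- total; so the trajectory already closes after the first copy.
  have c3 : cycleSum (displacement (sideCross u) (normalCross u)) w' = 0 := by
    rw [cycleSum_wordPow] at c2
    exact (mul_eq_zero.mp c2).resolve_left (by positivity)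
  have c4 : ((γ w'.length).state u).2 = ((γ 0).state u).2 := by
    change _ = _ - edgeSum _ _ (γ w'.length).side at s2
    rw [s2, hside]
    have e4 := cycleSum_eq (displacement (sideCross u) (normalCross u)) w' 0
    conv_rhs at e4 => rw [← htake]
    rw [headD_map_range _ hm] at e4
    rw [← e4, c3, sub_zero]
  refine hmin _ hm hmn ?_
  rw [← (h w'.length).1.crossingOf_state, ← (h 0).1.crossingOf_state]
  exact congrArg (crossingOf u) (Prod.ext hside c4)

theorem HasLoops.word_of_closed {u : ℂ} (hu : u ≠ 0) {a A : List (ZMod 5)} (h : HasLoops u a A)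
    {n : ℕ} {γ : ℕ → Crossing} (hγ : IsClosedTrajectory (Projectivization.mk ℝ u hu) n γ) :
    (((List.range n).map fun i => (γ i).side) ~r a ∨
      ((List.range n).map fun i => (γ i).side) ~r A) ∧
    scaledLength u ((List.range n).map fun i => (γ i).side) = 2 * ‖u‖ * trajectoryLength n γ := by
  obtain ⟨hn, hper, hmin, v, hv, hvp, hstep⟩ := hγ
  rw [Projectivization.submodule_mk, Submodule.mem_span_singleton] at hvp
  obtain ⟨r, rfl⟩ := hvp
  have hr : r ≠ 0 := left_ne_zero_of_smul hv
  have hp : γ n = γ 0 := by simpa using hper 0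
  have hloop : IsLoop (UStep (r • u)) ((List.range n).map fun i => (γ i).side) := by
    refine ⟨by simpa using hn.ne', (γ 0).state (r • u), ?_⟩
    have := isPath_of_forall (R := UStep (r • u)) (f := fun i => (γ i).state (r • u)) 0 n
      fun i _ _ => (hstep i).uStep
    simp only [zero_add, hp] at this
    exact this
  constructor
  · obtain ⟨k, hk, hw | hw⟩ := (h.smul hr).2.2.1 _ hloop
    · left
      have := wordPow_eq_one_of_periodic hn hp hmin hstep hw
      obtain rfl : k = 1 := by omega
      rwa [wordPow_one] at hw
    · right
      have := wordPow_eq_one_of_periodic hn hp hmin hstep hw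
      obtain rfl : k = 1 := by omega
      rwa [wordPow_one] at hw
  · have e := scaledLength_eq hn hp hstep
    rw [scaledLength_smul hloop, norm_smul, Real.norm_eq_abs] at e
    have : |r| ≠ 0 := abs_ne_zero.mpr hr
    apply mul_left_cancel₀ this
    rw [e]; ring

/-- An earlier return would split the loop into two loops, each longer than half of it. -/
theorem IsLoop.exists_closed {u : ℂ} (hu : u ≠ 0) {l : List (ZMod 5)} (h : IsLoop (UStep u) l)
    (hl : ∀ l', IsLoop (UStep u) l' → scaledLength u l < 2 * scaledLength u l') :
    ∃ n γ, IsClosedTrajectory (Projectivization.mk ℝ u hu) n γ ∧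
      ((List.range n).map fun i => (γ i).side) = l := by
  obtain ⟨f, hper, hstep, hf⟩ := h.exists_crossings
  have hn : 0 < l.length := List.length_pos_iff.mpr h.1
  have f0 : f l.length = f 0 := by simpa using hper 0
  refine ⟨l.length, fun i => crossingOf u (f i), ⟨hn, fun i => ?_, fun i hi0 hin hi => ?_,
    u, hu, ?_, fun i => (hstep i).step⟩, hf.symm⟩
  · change crossingOf u (f (i + l.length)) = crossingOf u (f i)
    rw [hper]
  · have hne : ∀ j, sideCross u (f j).1 ≠ 0 := fun j =>
      abs_pos.mp ((abs_nonneg _).trans_lt (hstep j).bounds.1)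
    have hi : f i = f 0 := by
      rw [← state_crossingOf (hne i), ← state_crossingOf (hne 0)]
      exact congrArg (Crossing.state u) hi
    obtain ⟨m, hm⟩ := Nat.exists_eq_add_of_le hin.le
    have p1 := isPath_of_forall (R := UStep u) (f := f) 0 i fun j _ _ => hstep j
    have p2 := isPath_of_forall (R := UStep u) (f := f) i m fun j _ _ => hstep j
    rw [← hm, f0, hi] at p2
    rw [zero_add, hi] at p1
    simp only [zero_add] at p1
    have e : ∀ (g : ℕ → ZMod 5 × ℝ) (k : ℕ), 0 < k → g k = g 0 →
        scaledLength u ((List.range k).map fun j => (g j).1) = ∑ j ∈ Finset.range k,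
          displacement (sideCross u) (normalCross (-Complex.I * u)) (g j).1 (g (j + 1)).1 := by
      intro g k hk hg
      rw [scaledLength, _root_.cycleSum_eq _ _ 0, headD_map_range _ hk, ← hg]
      exact edgeSum_map_range _ (fun j => (g j).1) k
    have hm0 : 0 < m := by omega
    have l1 := hl _ ⟨by simpa using hi0.ne', _, p1⟩
    have l2 := hl _ ⟨by simpa using hm0.ne', _, p2⟩
    have e0 := e f _ hn f0
    rw [← hf, hm, Finset.sum_range_add] at e0
    rw [e f i hi0 hi] at l1
    rw [e (fun j => f (i + j)) m hm0 (by simp only [← hm, f0, add_zero, hi])] at l2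
    simp only [add_assoc] at e0 l2
    linarith
  · rw [Projectivization.submodule_mk]
    exact Submodule.mem_span_singleton_self u

theorem HasLoops.ne_zero {u : ℂ} {a A : List (ZMod 5)} (h : HasLoops u a A) : u ≠ 0 := by
  obtain ⟨⟨ha, s, hs⟩, -⟩ := h
  rcases a with _ | ⟨c, a⟩
  · exact absurd rfl ha
  · obtain ⟨-, s', hs, -⟩ := hs
    exact hs.ne_zero

theorem HasLoops.hasSymbolicOrbits {u : ℂ} {a A : List (ZMod 5)} (h : HasLoops u a A) :
    HasSymbolicOrbits (Projectivization.mk ℝ u h.ne_zero) a A := by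
  have hu := h.ne_zero
  have hpos := h.1.scaledLength_pos
  have hA : scaledLength u A = Real.goldenRatio * scaledLength u a := h.2.2.2 _
  have hφ1 := Real.one_lt_goldenRatio
  have hφ2 := Real.goldenRatio_lt_two
  have haA : scaledLength u a < scaledLength u A := by nlinarith
  have hmin : ∀ l, IsLoop (UStep u) l → scaledLength u a ≤ scaledLength u l := by
    intro l hl
    obtain ⟨k, hk, hr | hr⟩ := h.2.2.1 l hl <;>
      rw [scaledLength, scaledLength, cycleSum_isRotated _ hr, cycleSum_wordPow]
    · change scaledLength u a ≤ k * scaledLength u a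
      have : (1 : ℝ) ≤ k := by exact_mod_cast hk
      nlinarith
    · change scaledLength u a ≤ k * scaledLength u A
      have : (1 : ℝ) ≤ k := by exact_mod_cast hk
      nlinarith
  have len : ∀ {l l' : List (ZMod 5)}, l ~r l' → scaledLength u l = scaledLength u l' :=
    fun hr => cycleSum_isRotated _ hr
  obtain ⟨n₁, γ₁, h₁, w₁⟩ := h.1.exists_closed hu fun l hl => by linarith [hmin l hl]
  -- Here `φ < 2` is needed: the long loop is shorter than twice the shortest one.
  obtain ⟨n₂, γ₂, h₂, w₂⟩ := h.2.1.exists_closed hu fun l hl => by nlinarith [hmin l hl]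
  have t₁ := (h.word_of_closed hu h₁).2
  have t₂ := (h.word_of_closed hu h₂).2
  rw [w₁] at t₁
  rw [w₂] at t₂
  have hnorm : 0 < 2 * ‖u‖ := by have := norm_pos_iff.mpr hu; linarith
  constructor
  · ext w
    rw [Set.mem_singleton_iff]
    constructor
    · rintro ⟨n, γ, hγ, rfl, hle⟩
      obtain ⟨hw | hw, t⟩ := h.word_of_closed hu hγ
      · exact Quotient.sound hw
      · have := mul_le_mul_of_nonneg_left (hle _ _ h₁) hnorm.le
        rw [← t, ← t₁, len hw] at this
        linarith
    · rintro rfl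
      refine ⟨n₁, γ₁, h₁, by rw [symbolicWord, w₁], fun n γ hγ => ?_⟩
      obtain ⟨hw, t⟩ := h.word_of_closed hu hγ
      rw [← mul_le_mul_iff_right₀ hnorm, ← t₁, ← t]
      rcases hw with hw | hw <;> rw [len hw]
      exact haA.le
  · ext w
    rw [Set.mem_singleton_iff]
    constructor
    · rintro ⟨n, γ, hγ, rfl, hle⟩
      obtain ⟨hw | hw, t⟩ := h.word_of_closed hu hγ
      · have := mul_le_mul_of_nonneg_left (hle _ _ h₂) hnorm.le
        rw [← t, ← t₂, len hw] at this
        linarith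
      · exact Quotient.sound hw
    · rintro rfl
      refine ⟨n₂, γ₂, h₂, by rw [symbolicWord, w₂], fun n γ hγ => ?_⟩
      obtain ⟨hw, t⟩ := h.word_of_closed hu hγ
      rw [← mul_le_mul_iff_right₀ hnorm, ← t₂, ← t]
      rcases hw with hw | hw <;> rw [len hw]
      exact haA.le

/-! ## Pentagons -/

/-- The directions of a side `i` of the initial pentagon and of the three vertices beyond it. -/
noncomputable def fan (i : ZMod 5) : Fin 5 → ℂ :=
  ![sideVec i, reflect i (sideVec (i - 1)), reflect i (sideVec (i - 2)),
    reflect i (sideVec (i - 3)), sideVec (i + 1)]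

/-- The five directions `d` lie in the sector `m + i`, and their words are reached from the base
words shifted by `i`. -/
def SectorLoops (i m : ZMod 5) (d : Fin 5 → ℂ) : Prop :=
  ∃ ws : Fin 10 → List (ZMod 5), Reached m ws ∧ ∀ r : Fin 5,
    HasLoops (d r) ((ws ⟨2 * r, by omega⟩).map (· + i)) ((ws ⟨2 * r + 1, by omega⟩).map (· + i)) ∧
    0 ≤ sideCross (d r) (m + i) * sideCross (d r) (m + i + 1)

theorem sideCross_reflect_mul (m : ZMod 5) (u : ℂ) :
    sideCross (reflect m u) m * sideCross (reflect m u) (m + 1) =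
      -(sideCross u m * sideCross u (m + 1)) := by
  rw [sideCross_reflect, sideCross_reflect_succ, neg_mul]

theorem sideCross_sideVec_sector {c m : ZMod 5} (h : m ≠ c) :
    sideCross (sideVec c) m * sideCross (sideVec c) (m + 1) ≤ 0 :=
  sideCross_sector (j := c) (by rw [sideCross_sideVec_self, zero_mul]) h

/-- The two ends bound the sector, and the other three directions are reflections of side directions
outside it. Their words are substituted two-letter words, so the cutting is a finite check. -/
theorem sectorLoops_fan (i : ZMod 5) : SectorLoops i 0 (fan i) := by
  have n1 : i ≠ i - 1 := by revert i; decide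
  have n2 : i ≠ i - 2 := by revert i; decide
  have n3 : i ≠ i - 3 := by revert i; decide
  refine ⟨baseWords, .base, fun r => ?_⟩
  rw [zero_add]
  fin_cases r
  · refine ⟨(hasLoops_sideVec i).isRotated (by revert i; decide) (by revert i; decide), ?_⟩
    change 0 ≤ sideCross (sideVec i) i * _
    rw [sideCross_sideVec_self, zero_mul]
  · refine ⟨(hasLoops_reflect_sideVec n1).isRotated (by clear n1 n2 n3; revert i; decide)
      (by clear n1 n2 n3; revert i; decide), ?_⟩
    change 0 ≤ sideCross (reflect i (sideVec (i - 1))) i * sideCross (reflect i (sideVec (i - 1))) _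
    rw [sideCross_reflect_mul]
    linarith [sideCross_sideVec_sector n1]
  · refine ⟨(hasLoops_reflect_sideVec n2).isRotated (by clear n1 n2 n3; revert i; decide)
      (by clear n1 n2 n3; revert i; decide), ?_⟩
    change 0 ≤ sideCross (reflect i (sideVec (i - 2))) i * sideCross (reflect i (sideVec (i - 2))) _
    rw [sideCross_reflect_mul]
    linarith [sideCross_sideVec_sector n2]
  · refine ⟨(hasLoops_reflect_sideVec n3).isRotated (by clear n1 n2 n3; revert i; decide)
      (by clear n1 n2 n3; revert i; decide), ?_⟩
    change 0 ≤ sideCross (reflect i (sideVec (i - 3))) i * sideCross (reflect i (sideVec (i - 3))) _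
    rw [sideCross_reflect_mul]
    linarith [sideCross_sideVec_sector n3]
  · refine ⟨(hasLoops_sideVec (i + 1)).isRotated (by clear n1 n2 n3; revert i; decide)
      (by clear n1 n2 n3; revert i; decide), ?_⟩
    change 0 ≤ _ * sideCross (sideVec (i + 1)) (i + 1)
    rw [sideCross_sideVec_self, mul_zero]

theorem SectorLoops.reflect {i m j : ZMod 5} {d : Fin 5 → ℂ} (h : SectorLoops i m d)
    (hj : j ≠ m + i) : SectorLoops i (j - i) fun r => reflect j (d r) := by
  obtain ⟨ws, hws, h⟩ := h
  refine ⟨_, hws.step (m' := j - i) fun e => hj (by rw [← e, sub_add_cancel]), fun r => ?_⟩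
  obtain ⟨h1, h2⟩ := h r
  have h3 := sideCross_sector h2 hj
  have h4 := h1.reflect h3
  rw [sub_add_cancel, sideCross_reflect_mul]
  refine ⟨?_, by linarith⟩
  have e := fun l => substitute_map_add (j - i) i l
  simp only [sub_add_cancel] at e
  simp only [← e]
  exact h4

/-- The reflection in a side of `g • initialPentagon` is the conjugate of `reflect i` by `g`, as the
values on the two side vectors show. Composing it with `g` thus multiplies `g` by `reflect i` on the
right. -/
theorem IsReflectionInSide.eq_smul {i : ZMod 5} {P Q : ZMod 5 → ℙ ℝ ℂ} {g : ℂ ≃ₗ[ℝ] ℂ}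
    (h : IsReflectionInSide i P Q) (hg : ∀ j, P j = g • initialPentagon j) (j : ZMod 5) :
    Q j = (g * reflect i) • initialPentagon j := by
  obtain ⟨f, h1, h2, h3⟩ := h
  have mem : ∀ j, g (sideVec j) ∈ (P j).submodule := by
    intro j
    rw [hg, initialPentagon, Projectivization.smul_mk, Projectivization.submodule_mk]
    exact Submodule.mem_span_singleton_self _
  have e0 := h1 _ (mem i)
  have e1 := h2 _ (mem (i + 1))
  have e : ∀ u, f (g u) = g (reflect i u) := by
    intro u
    have hδ := (sideCross_sideVec_neg).ne
    rw [← sideCross_sideVec_succ i] at hδ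
    have hu := cross_smul_eq (sideVec i) (sideVec (i + 1)) u
    apply smul_right_injective ℂ hδ
    change cross (sideVec i) (sideVec (i + 1)) • _ = cross (sideVec i) (sideVec (i + 1)) • _
    rw [← map_smul, ← map_smul, ← map_smul, ← map_smul, hu]
    simp only [map_sub, map_smul, e0, e1, reflect_sideVec, reflect_sideVec_succ, map_neg]
  rw [h3, hg, initialPentagon, Projectivization.smul_mk, Projectivization.smul_mk,
    Projectivization.smul_mk]
  congr 1
  exact e _

/-- New reflections enter on the right and act first on the fan, so the induction must allow
arbitrary `d` in an arbitrary sector. The condition on `o` is what excludes two equal consecutive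
reflections. -/
theorem IsPentagon.exists_linearEquiv {k : ℕ} {o : Option (ZMod 5)} {P : ZMod 5 → ℙ ℝ ℂ}
    (h : IsPentagon k o P) : ∃ g : ℂ ≃ₗ[ℝ] ℂ, (∀ j, P j = g • initialPentagon j) ∧
      ∀ i m d, SectorLoops i m d → o ≠ some (m + i) → ∃ m', SectorLoops i m' fun r => g (d r) := by
  induction h with
  | initial => exact ⟨1, fun j => (one_smul _ _).symm, fun i m d h _ => ⟨m, h⟩⟩
  | @next k o P Q i' _ ho hr ih =>
    obtain ⟨g, hg, ih⟩ := ih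
    refine ⟨g * reflect i', hr.eq_smul hg, fun i m d h hm => ?_⟩
    have hne : i' ≠ m + i := fun e => hm (congrArg some e)
    exact ih i (i' - i) _ (h.reflect hne) (by rwa [sub_add_cancel])

theorem HasSymbolicOrbits.congr {p : ℙ ℝ ℂ} {s l s' l' : List (ZMod 5)}
    (h : HasSymbolicOrbits p s l) (hs : s ~r s') (hl : l ~r l') : HasSymbolicOrbits p s' l' := by
  rw [HasSymbolicOrbits, ← Cycle.coe_eq_coe.mpr hs, ← Cycle.coe_eq_coe.mpr hl]
  exact h

theorem hasSymbolicOrbits_smul {g : ℂ ≃ₗ[ℝ] ℂ} {j : ZMod 5} {s l : List (ZMod 5)}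
    (h : HasLoops (g (sideVec j)) s l) : HasSymbolicOrbits (g • initialPentagon j) s l := by
  rw [initialPentagon, Projectivization.smul_mk]
  exact h.hasSymbolicOrbits

theorem theorem3 (k : ℕ) (p v₁ v₂ v₃ q : ℙ ℝ ℂ) (h : NextVertices k p v₁ v₂ v₃ q) :
    ∃ a A b B : List (ZMod 5),
      HasSymbolicOrbits p a A ∧
      HasSymbolicOrbits v₁ (b ++ A) (B ++ a ++ A) ∧
      HasSymbolicOrbits v₂ (A ++ B) (b ++ B ++ a ++ A) ∧
      HasSymbolicOrbits v₃ (a ++ B) (A ++ b ++ B) ∧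
      HasSymbolicOrbits q b B := by
  obtain ⟨o, P, Q, i, hP, ho, hQ, h⟩ := h
  obtain ⟨g, hg, hloops⟩ := hP.exists_linearEquiv
  have hgQ := hQ.eq_smul hg
  obtain ⟨m, ws, hws, hl⟩ := hloops i 0 _ (sectorLoops_fan i) (by rwa [zero_add])
  obtain ⟨a, A, b, B, hw⟩ := hws.exists_tenWords
  have hw' := fun r => (hw r).map (· + i)
  have h0 := ((hl 0).1.isRotated (hw' 0) (hw' 1))
  have h1 := ((hl 1).1.isRotated (hw' 2) (hw' 3))
  have h2 := ((hl 2).1.isRotated (hw' 4) (hw' 5))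
  have h3 := ((hl 3).1.isRotated (hw' 6) (hw' 7))
  have h4 := ((hl 4).1.isRotated (hw' 8) (hw' 9))
  have o0 := hasSymbolicOrbits_smul (g := g) (j := i) h0
  have o1 := hasSymbolicOrbits_smul (g := g * reflect i) (j := i - 1) h1
  have o2 := hasSymbolicOrbits_smul (g := g * reflect i) (j := i - 2) h2
  have o3 := hasSymbolicOrbits_smul (g := g * reflect i) (j := i - 3) h3
  have o4 := hasSymbolicOrbits_smul (g := g) (j := i + 1) h4
  rw [← hg] at o0 o4
  rw [← hgQ] at o1 o2 o3
  rcases h with ⟨rfl, rfl, rfl, rfl, rfl⟩ | ⟨rfl, rfl, rfl, rfl, rfl⟩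
  · refine ⟨a.map (· + i), A.map (· + i), b.map (· + i), B.map (· + i), o0, ?_, ?_, ?_, o4⟩ <;>
      simp only [← List.map_append]
    · exact o1
    · exact o2
    · exact o3
  -- Listing the vertices in the opposite order exchanges `(a, A)` with `(b, B)`; this swaps the
  -- words of `v₁` and `v₃` and only rotates those of `v₂`.
  · refine ⟨b.map (· + i), B.map (· + i), a.map (· + i), A.map (· + i), o4, ?_, ?_, ?_, o0⟩ <;>
      simp only [← List.map_append]
    · exact o3
    · refine o2.congr (List.IsRotated.map ?_ _) (List.IsRotated.map ?_ _)
      · exact List.isRotated_append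
      · have : b ++ B ++ a ++ A = (b ++ B) ++ (a ++ A) := by simp
        change b ++ B ++ a ++ A ~r a ++ A ++ b ++ B
        rw [this, List.append_assoc (a ++ A)]
        exact List.isRotated_append
    · exact o1
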